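/- **Setting.** Let $\mathcal X\subseteq\mathbb R^d$ and $\mathcal Y\subseteq\mathbb R^{d'}$ be nonempty closed convex sets with (Euclidean) diameters at most $R>0$ and $R'>0$. Let $0<\mu\le L$, and let $f:\mathcal X\times\mathcal Y\to\mathbb R$ be differentiable and $L$-smooth (its gradient is $L$-Lipschitz on $\mathcal X\times\mathcal Y$), convex in $x$ for every $y$ and $\mu$-strongly concave in $y$ for every $x$. Put $F(x)=\max_{y\in\mathcal Y}f(x,y)$. A gradient query at $(x,y)$ returns $(\nabla_xf(x,y),\nabla_yf(x,y))$, and a best-response call at $x$ returns $y^{\mathrm{br}}_x=\arg\max_{y\in\mathcal Y}f(x,y)$. Let $(x_{\rm init},y_{\rm init})\in\mathcal X\times\mathcal Y$ be arbitrary, let $\epsilon>0$, and write $\log^+ z=\max\{0,\log z\}$. **Algorithms.** * $\textsc{MirrorProx}(\phi,\ell,x_0,y_0,M)$: with $\eta=1/\ell$, for $t=0,\dots,M-1$ let $u_t=\arg\min_{x\in\mathcal X}\langle\eta\nabla_x\phi(x_t,y_t),x\rangle+\frac12\|x-x_t\|^2$, $v_t=\arg\min_{y\in\mathcal Y}\langle-\eta\nabla_y\phi(x_t,y_t),y\rangle+\frac12\|y-y_t\|^2$,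 and let $x_{t+1},y_{t+1}$ be given by the same formulas with the gradients taken at $(u_t,v_t)$ instead of $(x_t,y_t)$. Output the average $\frac1M\sum_{t<M}(u_t,v_t)$. * $\textsc{ApproxProx}(s;x_{\rm i},x_{\rm p})$: the $x$-part of the output of $\textsc{MirrorProx}(\phi,L+\mu,x_{\rm i},y^{\mathrm{br}}_{x_{\rm p}},M)$ for $\phi(x,y)=f(x,y)+\frac\mu2\|x-s\|^2$. * $\textsc{UnbiasedProx}(s;x_{\rm p})$: let $x^{(0)}=\textsc{ApproxProx}(s;s,x_{\rm p})$; draw $J_+$ with $\mathbb P(J_+=k)=2^{-(k+1)}$, $k=0,1,2,\dots$; let $J=2+J_+$ and $x^{(j+1)}=\textsc{ApproxProx}(s;x^{(j)},x^{(j)})$ for $0\le j<J$; output $x^{(2)}+2^{J_++1}\bigl(x^{(J)}-x^{(\max\{J-1,2\})}\bigr)$. * $\textsc{WarmStart}$: find $y'\in\mathcal Y$ with $F(x_{\rm init})-f(x_{\rm init},y')\le\frac12LR^2$ by accelerated gradient ascent on $f(x_{\rm init},\cdot)$ from $y_{\rm init}$ (one projected gradient step, giving $y_1=z_1$, then $N$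 accelerated steps $w=(y+\theta z)/(1+\theta)$, $z^+=\mathrm{Proj}_{\mathcal Y}\bigl((1-\theta)z+\theta w+\frac\theta\mu\nabla_yf(x_{\rm init},w)\bigr)$, $y^+=(1-\theta)y+\theta z^+$, with $\theta=\sqrt{\mu/L}$; output the last $y$). Then, starting from $(x_{\rm init},y')$, apply $K_{\rm w}$ times $(x,y)\mapsto\textsc{MirrorProx}(\phi,L+\mu,x,y,T_{\rm w})$ with $\phi(x,y)=f(x,y)+\frac\mu2\|x-x_{\rm init}\|^2$, and output the last $x$. * RECAPP with $\lambda=\mu$ and step budget $T$: let $x_0=v_0$ be the output of $\textsc{WarmStart}$ and $\alpha_0=1$. For $t=0,\dots,T-1$ let $\alpha_{t+1}\in[0,1]$ solve $\alpha_{t+1}^{-2}-\alpha_{t+1}^{-1}=\alpha_t^{-2}$, let $s_t=(1-\alpha_{t+1})x_t+\alpha_{t+1}v_t$, $x_{t+1}=\textsc{ApproxProx}(s_t;s_t,x_t)$, $\tilde x_{t+1}=\textsc{UnbiasedProx}(s_t;x_t)$ (run independently of the past), and $v_{t+1}=\mathrm{Proj}_{\mathcal X}\bigl(v_t-\alpha_{t+1}^{-1}(s_t-\tilde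 x_{t+1})\bigr)$. Output $x_T$. * Restarted RECAPP: one $\textsc{WarmStart}$ gives $x^{(0)}$. Then, for $k=0,\dots,K-1$, $x^{(k+1)}$ is the output of $T$ iterations of RECAPP from $x_0=v_0=x^{(k)}$, without warm start. Output $x^{(K)}$. **Theorem.** There is a universal constant $C$ such that the following holds. 1. For all $0<\mu\le L$ and $R,R',\epsilon>0$ there are parameters, depending on these numbers only, with $M,T_{\rm w}\le C\,L/\mu$, $K_{\rm w}\le C(1+\log(L/\mu))$, $N\le C(1+\sqrt{L/\mu}\,\log^+(R'/R))$ and $T\le C\,R\sqrt{\mu/\epsilon}$, such that for every problem as in the setting, $F$ attains its minimum over $\mathcal X$, the accelerated gradient phase of $\textsc{WarmStart}$ reaches its required accuracy, and RECAPP outputs $x\in\mathcal X$ with $\mathbb E F(x)-\min_{x'\in\mathcal X}F(x')\le\epsilon$, using in expectation at most $$C\Bigl(\frac{LR}{\sqrt{\mu\epsilon}}+\frac L\mu\Bigl(1+\log\frac L\mu\Bigr)+\sqrt{\frac L\mu}\,\log^+\frac{R'}R\Bigr)$$ gradient queries and at most $C\,R\sqrt{\mu/\epsilon}$ best-response calls.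 2. For all $0<\gamma\le\mu\le L$ and $R,R',\epsilon>0$ there are parameters, depending on these numbers only, with the same bounds on $M,T_{\rm w},K_{\rm w},N$ and with $T\le C\sqrt{\mu/\gamma}$ and $K\le C\log^+(LR^2/\epsilon)$, such that for every problem as in the setting for which $F$ is moreover $\gamma$-strongly convex on $\mathcal X$, $F$ attains its minimum over $\mathcal X$, the accelerated gradient phase of $\textsc{WarmStart}$ reaches its required accuracy, and restarted RECAPP outputs $x\in\mathcal X$ with $\mathbb E F(x)-\min_{x'\in\mathcal X}F(x')\le\epsilon$, using in expectation at most $$C\Bigl(\frac{L}{\sqrt{\mu\gamma}}\log^+\frac{LR^2}\epsilon+\frac L\mu\Bigl(1+\log\frac L\mu\Bigr)+\sqrt{\frac L\mu}\,\log^+\frac{R'}R\Bigr)$$ gradient queries and at most $C\sqrt{\mu/\gamma}\,\log^+(LR^2/\epsilon)$ best-response calls. -/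

import Mathlib

open scoped ENNReal RealInnerProductSpace

noncomputable section

namespace Recapp

/-! ### Randomized programs with query counting -/

/-- A pair (number of gradient queries, number of best-response calls). -/
abbrev Cost : Type := ℕ × ℕ

/-- A randomized program with output in `α`: the joint law of its output and of the number of
oracle queries that it makes. -/
def Alg (α : Type) : Type := PMF (α × Cost)

namespace Alg

/-- The joint law of output and cost. -/
def law {α : Type} (m : Alg α) : PMF (α × Cost) := m

/-- Sequential composition runs the second program on the output of the first one and adds up the
costs; returning a value is free. -/
instance : Monad Alg where
  pure a := PMF.pure (a, (0, 0))
  bind m k := PMF.bind (law m) fun r => PMF.map (fun q => (q.1, r.2 + q.2)) (law (k r.1))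

/-- Draw from a distribution, at no cost. -/
def draw {α : Type} (p : PMF α) : Alg α := PMF.map (fun a => (a, ((0, 0) : Cost))) p

/-- Evaluate a gradient oracle: one gradient query. -/
def gradQuery {α : Type} (a : α) : Alg α := PMF.pure (a, (1, 0))

/-- Evaluate a best-response oracle: one best-response call. -/
def brQuery {α : Type} (a : α) : Alg α := PMF.pure (a, (0, 1))

/-- `for t = 0, …, n - 1 do state ← step t state`. -/
def loop {σ : Type} (step : ℕ → σ → Alg σ) : ℕ → σ → Alg σ
  | 0, s => pure s
  | n + 1, s => do
    let s' ← loop step n s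
    step n s'

/-- Expectation of a nonnegative function of output and cost. -/
def expect {α : Type} (m : Alg α) (h : α × Cost → ℝ≥0∞) : ℝ≥0∞ := ∑' r, law m r * h r

/-- Expected number of gradient queries. -/
def expectedGrad {α : Type} (m : Alg α) : ℝ≥0∞ := expect m fun r => (r.2.1 : ℝ≥0∞)

/-- Expected number of best-response calls. -/
def expectedBr {α : Type} (m : Alg α) : ℝ≥0∞ := expect m fun r => (r.2.2 : ℝ≥0∞)

end Alg

/-- The geometric distribution on `{0, 1, 2, …}` with success probability `1/2`. -/
def geomHalf : PMF ℕ :=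
  ⟨fun k => 2⁻¹ ^ (k + 1), by
    have h : ∑' k : ℕ, (2⁻¹ : ℝ≥0∞) ^ (k + 1) = 1 := by
      simp_rw [pow_succ]
      rw [ENNReal.tsum_mul_right, ENNReal.tsum_geometric, ENNReal.one_sub_inv_two, inv_inv]
      exact ENNReal.mul_inv_cancel (by norm_num) (by norm_num)
    exact h ▸ ENNReal.summable.hasSum⟩

/-! ### Argmin, projection, and the problem class -/

section

variable {E E' : Type} [NormedAddCommGroup E] [InnerProductSpace ℝ E]
  [NormedAddCommGroup E'] [InnerProductSpace ℝ E']

/-- A minimizer of `h` over `S` (meaningful when there is one; below it always exists and is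
unique). -/
def argminOn (S : Set E) (h : E → ℝ) : E := Classical.epsilon fun u => u ∈ S ∧ IsMinOn h S u

/-- Euclidean projection onto `S`. -/
def proj (S : Set E) (x : E) : E := argminOn S fun u => ‖x - u‖

/-- The step `argmin_{u ∈ S} ⟨g, u⟩ + ‖u - x‖² / 2`. -/
def mirrorStep (S : Set E) (x g : E) : E := argminOn S fun u => ⟪g, u⟫ + ‖u - x‖ ^ 2 / 2

/-- What the algorithms may use: the feasible sets, the two constants, an oracle returning both
partial gradients of `f`, and an oracle returning a best response. -/
structure Access (E E' : Type) where
  X : Set E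
  Y : Set E'
  L : ℝ
  μ : ℝ
  grad : E → E' → E × E'
  br : E → E'

/-- The objective `F(x) = max_{y ∈ Y} f(x, y)`. -/
def maxFun (f : E → E' → ℝ) (Y : Set E') (x : E) : ℝ := sSup (f x '' Y)

/-- `P` gives access to an `L`-smooth function `f` on `X × Y`, convex in `x` and `μ`-strongly
concave in `y`, where `X` and `Y` are nonempty closed convex sets whose diameters are at most `R`
and `R'`. -/
structure IsMaxStructured (P : Access E E') (f : E → E' → ℝ) (R R' : ℝ) : Prop where
  nonempty_X : P.X.Nonempty
  closed_X : IsClosed P.X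
  convex_X : Convex ℝ P.X
  diam_X : ∀ x ∈ P.X, ∀ x' ∈ P.X, ‖x - x'‖ ≤ R
  nonempty_Y : P.Y.Nonempty
  closed_Y : IsClosed P.Y
  convex_Y : Convex ℝ P.Y
  diam_Y : ∀ y ∈ P.Y, ∀ y' ∈ P.Y, ‖y - y'‖ ≤ R'
  hasGrad : ∀ x ∈ P.X, ∀ y ∈ P.Y,
    HasFDerivWithinAt (fun z : E × E' => f z.1 z.2)
      ((innerSL ℝ (P.grad x y).1).coprod (innerSL ℝ (P.grad x y).2)) (P.X ×ˢ P.Y) (x, y)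
  smooth : ∀ x ∈ P.X, ∀ y ∈ P.Y, ∀ x' ∈ P.X, ∀ y' ∈ P.Y,
    ‖(P.grad x y).1 - (P.grad x' y').1‖ ^ 2 + ‖(P.grad x y).2 - (P.grad x' y').2‖ ^ 2
      ≤ P.L ^ 2 * (‖x - x'‖ ^ 2 + ‖y - y'‖ ^ 2)
  convex_x : ∀ y ∈ P.Y, ConvexOn ℝ P.X fun x => f x y
  concave_y : ∀ x ∈ P.X, StrongConcaveOn P.Y P.μ (f x)
  br_mem : ∀ x ∈ P.X, P.br x ∈ P.Y
  br_max : ∀ x ∈ P.X, IsMaxOn (f x) P.Y (P.br x)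

/-! ### MirrorProx -/

/-- One query to the gradient of `(x, y) ↦ f(x, y) + (μ / 2) ‖x - s‖²`. -/
def regGrad (P : Access E E') (s x : E) (y : E') : Alg (E × E') := do
  let g ← Alg.gradQuery (P.grad x y)
  pure (g.1 + P.μ • (x - s), g.2)

/-- One iteration of MirrorProx with gradient oracle `q` and step size `η`. The first component of
the state is `(x_t, y_t)`, the second one is the running sum of the points `(u_t, v_t)`. -/
def mirrorProxStep (X : Set E) (Y : Set E') (q : E → E' → Alg (E × E')) (η : ℝ)
    (S : (E × E') × (E × E')) : Alg ((E × E') × (E × E')) := do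
  let g ← q S.1.1 S.1.2
  let u := mirrorStep X S.1.1 (η • g.1)
  let v := mirrorStep Y S.1.2 (-(η • g.2))
  let g' ← q u v
  let x' := mirrorStep X S.1.1 (η • g'.1)
  let y' := mirrorStep Y S.1.2 (-(η • g'.2))
  pure ((x', y'), S.2 + (u, v))

/-- `T` iterations of MirrorProx from `z₀ = (x_init, y_init)` with step size `1 / ℓ`, where `ℓ` is
the smoothness constant; the output is the average of the points `(u_t, v_t)`. -/
def mirrorProx (X : Set E) (Y : Set E') (q : E → E' → Alg (E × E')) (ℓ : ℝ) (z₀ : E × E')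
    (T : ℕ) : Alg (E × E') := do
  let S ← Alg.loop (fun _ => mirrorProxStep X Y q (1 / ℓ)) T (z₀, 0)
  pure ((T : ℝ)⁻¹ • S.2)

/-! ### ApproxProx, UnbiasedProx, WarmStart -/

/-- ApproxProx for `F` with `λ = μ`: `M` iterations of MirrorProx on `f(x, y) + (μ / 2) ‖x - s‖²`
from `x_init` and a best response to `x_prev`. -/
def approxProx (P : Access E E') (M : ℕ) (s xinit xprev : E) : Alg E := do
  let y ← Alg.brQuery (P.br xprev)
  let z ← mirrorProx P.X P.Y (regGrad P s) (P.L + P.μ) (xinit, y) M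
  pure z.1

/-- UnbiasedProx by multilevel Monte Carlo with geometric parameter `p = 1/2` and offset `j₀`. The
sequence `h` records the iterates `x⁽⁰⁾, …, x⁽ᴶ⁾`. -/
def unbiasedProx (P : Access E E') (M j₀ : ℕ) (s xprev : E) : Alg E := do
  let x0 ← approxProx P M s s xprev
  let Jp ← Alg.draw geomHalf
  let J := j₀ + Jp
  let h ← Alg.loop (fun j (h : ℕ → E) => do
      let x ← approxProx P M s (h j) (h j)
      pure (Function.update h (j + 1) x)) J (fun _ => x0)
  let pJ : ℝ := (1 - 1 / 2) * (1 / 2) ^ Jp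
  pure (h j₀ + pJ⁻¹ • (h J - h (max (J - 1) j₀)))

/-- One step of accelerated gradient ascent for the `μ`-strongly concave, `L`-smooth function
`f(x, ·)` on `Y`; the state is `(y_k, z_k)` and `θ = √(μ / L)`. -/
def agdStep (P : Access E E') (x : E) (S : E' × E') : Alg (E' × E') := do
  let θ := Real.sqrt (P.μ / P.L)
  let w := (1 + θ)⁻¹ • (S.1 + θ • S.2)
  let g ← Alg.gradQuery (P.grad x w)
  let z := mirrorStep P.Y ((1 - θ) • S.2 + θ • w) (-((θ / P.μ) • g.2))
  pure ((1 - θ) • S.1 + θ • z, z)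

/-- Accelerated gradient ascent on `f(x, ·)` over `Y`: one projected gradient step from `y₀`,
followed by `N` accelerated steps. -/
def agd (P : Access E E') (x : E) (y₀ : E') (N : ℕ) : Alg E' := do
  let g ← Alg.gradQuery (P.grad x y₀)
  let y₁ := mirrorStep P.Y y₀ (-((1 / P.L) • g.2))
  let S ← Alg.loop (fun _ => agdStep P x) N (y₁, y₁)
  pure S.1

/-- Parameters of WarmStart-MirrorProx: number of accelerated gradient steps, number of MirrorProx
iterations in an epoch, number of epochs. -/
structure WarmParams where
  N : ℕ
  T : ℕ
  K : ℕ

/-- WarmStart-MirrorProx. -/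
def warmStart (P : Access E E') (w : WarmParams) (xinit : E) (yinit : E') : Alg E := do
  let y' ← agd P xinit yinit w.N
  let z ← Alg.loop (fun _ z => mirrorProx P.X P.Y (regGrad P xinit) (P.L + P.μ) z w.T) w.K
    (xinit, y')
  pure z.1

/-! ### RECAPP -/

/-- The sequence `α_t`: `α_0 = 1` and `α_{t+1}` is the solution in `[0, 1]` of
`1 / α_{t+1}² - 1 / α_{t+1} = 1 / α_t²`. -/
def alpha : ℕ → ℝ
  | 0 => 1
  | t + 1 => 2 / (1 + Real.sqrt (1 + 4 / alpha t ^ 2))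

theorem alpha_pos (t : ℕ) : 0 < alpha t := by
  cases t with
  | zero => simp [alpha]
  | succ t => rw [alpha]; positivity

theorem alpha_le_one (t : ℕ) : alpha t ≤ 1 := by
  cases t with
  | zero => simp [alpha]
  | succ t =>
    have h := alpha_pos t
    have h1 : (1 : ℝ) ≤ Real.sqrt (1 + 4 / alpha t ^ 2) := by
      rw [Real.one_le_sqrt]
      have : 0 ≤ 4 / alpha t ^ 2 := by positivity
      linarith
    rw [alpha, div_le_one (by positivity)]
    linarith

theorem alpha_succ (t : ℕ) :
    1 / alpha (t + 1) ^ 2 - 1 / alpha (t + 1) = 1 / alpha t ^ 2 := by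
  have h := alpha_pos t
  have hs : Real.sqrt (1 + 4 / alpha t ^ 2) ^ 2 = 1 + 4 / alpha t ^ 2 :=
    Real.sq_sqrt (by positivity)
  have h2 : 4 / alpha t ^ 2 = 4 * (1 / alpha t ^ 2) := by ring
  rw [h2] at hs
  rw [alpha, h2, one_div_div, div_pow, one_div_div]
  nlinarith [hs]

/-- Iteration `t` of RECAPP with `λ = μ`; the state is `(x_t, v_t)`. -/
def recappStep (P : Access E E') (M j₀ t : ℕ) (S : E × E) : Alg (E × E) := do
  let a := alpha (t + 1)
  let s := (1 - a) • S.1 + a • S.2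
  let x' ← approxProx P M s s S.1
  let xt ← unbiasedProx P M j₀ s S.1
  pure (x', proj P.X (S.2 - a⁻¹ • (s - xt)))

/-- `T` iterations of RECAPP from `x_0 = v_0`. -/
def recappFrom (P : Access E E') (M j₀ T : ℕ) (x₀ : E) : Alg E := do
  let S ← Alg.loop (recappStep P M j₀) T (x₀, x₀)
  pure S.1

/-- RECAPP with warm start. -/
def recapp (P : Access E E') (w : WarmParams) (M j₀ T : ℕ) (xinit : E) (yinit : E') :
    Alg E := do
  let x₀ ← warmStart P w xinit yinit
  recappFrom P M j₀ T x₀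

/-- Restarted RECAPP: a warm start and then `K` epochs of `T` iterations each. -/
def restartedRecapp (P : Access E E') (w : WarmParams) (M j₀ T K : ℕ) (xinit : E) (yinit : E') :
    Alg E := do
  let x₀ ← warmStart P w xinit yinit
  Alg.loop (fun _ x => recappFrom P M j₀ T x) K x₀

/-! ### Bounds -/

/-- The warm-start parameters are at most `C` times `1 + √(L/μ) log⁺(R'/R)`, `L/μ` and
`1 + log(L/μ)`. -/
structure WarmParams.Bounded (w : WarmParams) (C L μ R R' : ℝ) : Prop where
  N_le : (w.N : ℝ) ≤ C * (1 + Real.sqrt (L / μ) * Real.posLog (R' / R))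
  T_le : (w.T : ℝ) ≤ C * (L / μ)
  K_le : (w.K : ℝ) ≤ C * (1 + Real.log (L / μ))

/-- The program `A` always returns a point of `X`, the function `F` has a minimizer on `X`, the
expected suboptimality of the output of `A` is at most `ε`, and the expected numbers of gradient
queries and of best-response calls are at most `G` and `B`. -/
structure Solves (A : Alg E) (X : Set E) (F : E → ℝ) (ε G B : ℝ) : Prop where
  mem : ∀ r ∈ A.law.support, r.1 ∈ X
  subopt : ∃ xs ∈ X, IsMinOn F X xs ∧
    A.expect (fun r => ENNReal.ofReal (F r.1 - F xs)) ≤ ENNReal.ofReal ε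
  grad_le : A.expectedGrad ≤ ENNReal.ofReal G
  br_le : A.expectedBr ≤ ENNReal.ofReal B

end

end Recapp

end

noncomputable section

namespace Recapp

open Filter Topology

/-! ### Calculus and projections -/

section Calculus

/-! RECAPP is an accelerated proximal point method whose proximal steps are solved only to constant
relative accuracy. For a centre s, let xs minimize F + (μ/2)‖· - s‖²; then (xs, br xs) is a saddle
point of the regularized function. The error of a point u is measured by A(u) = D(u) + (μ/2)‖u -
xs‖², where D is the Bregman divergence of F from xs.

Strong concavity gives (μ/2)‖br u - br xs‖² ≤ D(u) (`br_sq_le_divergence`), so a best-response call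
at u starts MirrorProx with a dual error already paid for by D(u). The MirrorProx gap after M steps
is at most (L+μ)/(2M) times the squared distance from start to comparator (`extragrad_gap`). Taking
(xs, br(output)) as comparator and M about 80 L/μ, the error contracts by 1/16, with no logarithm
(`divergence_extragrad_le`).

Iterating this contraction gives a geometrically convergent sequence. Randomized telescoping then
yields an estimator with mean exactly xs (`hasSum_inner_unbiasedOut`). Its second moment is finite
because 2^(-k) · 4^k · 16^(-k) is summable (`sq_unbiasedOut_le`), and its expected number of calls
is a constant.

The potential α_t^(-2)(F(x_t) - F(z)) + (μ/2)‖v_t - z‖² does not increase in expectation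
(`expect_potential_le`): unbiasedness removes the cross term, and the remaining errors are small
multiples of D(x_t) + (μ/2)‖s - xs‖², absorbed by slack in the exact proximal argument
(`recapp_descent`). Since α_T ≤ 2/(T+2), the error decays like 1/T².

The warm start brings F - min F down to (3/4)μR², so the initial potential is of order μR²
(`maxFun_warmOut_le`). Accelerated ascent makes the dual error polynomial in L/μ, and O(log(L/μ))
contracting epochs remove that factor. Under γ-strong convexity of F, the quadratic part of the
potential is at most (μ/γ)(F - min F), so O(√(μ/γ)) iterations shrink the gap by 1/e and restarting
gives a linear rate (`expect_epoch_le`). -/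

theorem le_of_hasDerivWithinAt_of_le {h : ℝ → ℝ} {d c e : ℝ}
    (hd : HasDerivWithinAt h d (Set.Icc 0 1) 0)
    (hh : ∀ t ∈ Set.Ioo (0 : ℝ) 1, t * (c - t * e) ≤ h t - h 0) : c ≤ d := by
  have h1 : HasDerivWithinAt h d (Set.Ioo 0 1) 0 := hd.mono Set.Ioo_subset_Icc_self
  rw [hasDerivWithinAt_iff_tendsto_slope' (by simp)] at h1
  have : (𝓝[Set.Ioo (0 : ℝ) 1] 0).NeBot := by
    rw [nhdsWithin_Ioo_eq_nhdsGT one_pos]; infer_instance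
  have h2 : Tendsto (fun t : ℝ => c - t * e) (𝓝[Set.Ioo 0 1] 0) (𝓝 c) := by
    have hc : Continuous fun t : ℝ => c - t * e := by fun_prop
    simpa using (hc.tendsto 0).mono_left nhdsWithin_le_nhds
  refine le_of_tendsto_of_tendsto h2 h1 ?_
  filter_upwards [self_mem_nhdsWithin] with t ht
  rw [slope_def_field, sub_zero, le_div_iff₀ ht.1]
  linarith [hh t ht]

/-- If `0 ≤ a + t b` for all small positive `t`, then `0 ≤ a`. -/
theorem nonneg_of_forall_add_mul_nonneg {a b : ℝ}
    (h : ∀ t ∈ Set.Ioo (0 : ℝ) 1, 0 ≤ a + t * b) : 0 ≤ a := by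
  have hd : HasDerivWithinAt (fun t : ℝ => t * a) a (Set.Icc 0 1) 0 := by
    simpa using ((hasDerivAt_id (0 : ℝ)).mul_const a).hasDerivWithinAt
  refine le_of_hasDerivWithinAt_of_le (e := b) hd fun t ht => ?_
  nlinarith [mul_nonneg ht.1.le (h t ht)]

end Calculus

variable {E E' : Type} [NormedAddCommGroup E] [InnerProductSpace ℝ E]
  [NormedAddCommGroup E'] [InnerProductSpace ℝ E']

section Prox

theorem norm_sub_sq_add (a b c : E) :
    ‖a - c‖ ^ 2 = ‖a - b‖ ^ 2 + 2 * ⟪a - b, b - c⟫ + ‖b - c‖ ^ 2 := by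
  rw [← norm_add_sq_real, sub_add_sub_cancel]

theorem norm_sub_sq_le_two_mul (a b c : E) :
    ‖a - c‖ ^ 2 ≤ 2 * ‖a - b‖ ^ 2 + 2 * ‖b - c‖ ^ 2 := by
  have h1 : ‖a - c‖ ≤ ‖a - b‖ + ‖b - c‖ := norm_sub_le_norm_sub_add_norm_sub a b c
  nlinarith [sq_nonneg (‖a - b‖ - ‖b - c‖), norm_nonneg (a - c)]

theorem argminOn_spec {S : Set E} (hS : IsCompact S) (hne : S.Nonempty) {h : E → ℝ}
    (hc : Continuous h) : argminOn S h ∈ S ∧ IsMinOn h S (argminOn S h) :=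
  Classical.epsilon_spec (hS.exists_isMinOn hne hc.continuousOn)

/-- The three-point inequality for a minimizer of `⟪g, u⟫ + ‖u - x‖² / 2`. -/
theorem three_point {S : Set E} (hS : Convex ℝ S) {x g p w : E} (hp : p ∈ S) (hw : w ∈ S)
    (hmin : IsMinOn (fun u => ⟪g, u⟫ + ‖u - x‖ ^ 2 / 2) S p) :
    ⟪g, p - w⟫ ≤ ‖w - x‖ ^ 2 / 2 - ‖w - p‖ ^ 2 / 2 - ‖p - x‖ ^ 2 / 2 := by
  -- First-order optimality at p, obtained by moving a small t towards w; the t² term is negligible.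
  have key : 0 ≤ ⟪g, w - p⟫ + ⟪w - p, p - x⟫ := by
    refine nonneg_of_forall_add_mul_nonneg (b := ‖w - p‖ ^ 2 / 2) fun t ht => ?_
    have hmem : p + t • (w - p) ∈ S := hS.add_smul_sub_mem hp hw ⟨ht.1.le, ht.2.le⟩
    have h1 : ⟪g, p⟫ + ‖p - x‖ ^ 2 / 2
        ≤ ⟪g, p + t • (w - p)⟫ + ‖p + t • (w - p) - x‖ ^ 2 / 2 := hmin hmem
    have h2 := norm_sub_sq_add (p + t • (w - p)) p x
    rw [add_sub_cancel_left, norm_smul, real_inner_smul_left, Real.norm_eq_abs, mul_pow,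
      sq_abs] at h2
    rw [h2, inner_add_right, real_inner_smul_right] at h1
    have h3 : 0 ≤ t * (⟪g, w - p⟫ + ⟪w - p, p - x⟫ + t * (‖w - p‖ ^ 2 / 2)) := by
      linarith [h1, sq t]
    exact nonneg_of_mul_nonneg_right h3 ht.1
  have h4 := norm_sub_sq_add w p x
  have h5 : ⟪g, p - w⟫ = -⟪g, w - p⟫ := by rw [← inner_neg_right, neg_sub]
  linarith

variable {S : Set E}

theorem mirrorStep_spec (hS : IsCompact S) (hne : S.Nonempty) (x g : E) :
    mirrorStep S x g ∈ S ∧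
      IsMinOn (fun u => ⟪g, u⟫ + ‖u - x‖ ^ 2 / 2) S (mirrorStep S x g) :=
  argminOn_spec hS hne (by fun_prop)

theorem mirrorStep_mem (hS : IsCompact S) (hne : S.Nonempty) (x g : E) : mirrorStep S x g ∈ S :=
  (mirrorStep_spec hS hne x g).1

theorem mirrorStep_three_point (hS : IsCompact S) (hc : Convex ℝ S) (x g : E) {w : E}
    (hw : w ∈ S) :
    ⟪g, mirrorStep S x g - w⟫
      ≤ ‖w - x‖ ^ 2 / 2 - ‖w - mirrorStep S x g‖ ^ 2 / 2 - ‖mirrorStep S x g - x‖ ^ 2 / 2 :=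
  have h := mirrorStep_spec hS ⟨w, hw⟩ x g
  three_point hc h.1 hw h.2

theorem proj_mem (hS : IsCompact S) (hne : S.Nonempty) (x : E) : proj S x ∈ S :=
  (argminOn_spec hS hne (by fun_prop)).1

/-- The projection is the mirror step with zero linear term, so this is the three-point inequality
at g = 0. -/
theorem norm_proj_sub_sq_le (hS : IsCompact S) (hc : Convex ℝ S) (x : E) {w : E} (hw : w ∈ S) :
    ‖proj S x - w‖ ^ 2 ≤ ‖x - w‖ ^ 2 := by
  have h : proj S x ∈ S ∧ IsMinOn (fun u => ‖x - u‖) S (proj S x) :=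
    argminOn_spec hS ⟨w, hw⟩ (by fun_prop)
  have hmin : IsMinOn (fun u => ⟪(0 : E), u⟫ + ‖u - x‖ ^ 2 / 2) S (proj S x) := by
    intro u hu
    have h1 : ‖x - proj S x‖ ≤ ‖x - u‖ := h.2 hu
    rw [norm_sub_rev x, norm_sub_rev x] at h1
    have : ‖proj S x - x‖ ^ 2 ≤ ‖u - x‖ ^ 2 := by gcongr
    simp only [inner_zero_left, zero_add, Set.mem_ofPred_eq]
    linarith
  have h3 := three_point hc h.1 hw hmin
  rw [inner_zero_left] at h3
  rw [norm_sub_rev _ w, norm_sub_rev x]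
  nlinarith [sq_nonneg ‖proj S x - x‖]

end Prox

/-! ### First-order inequalities for f and regularity of best responses. -/

namespace IsMaxStructured

variable {P : Access E E'} {f : E → E' → ℝ} {R R' : ℝ}

theorem isCompact_X [FiniteDimensional ℝ E] (h : IsMaxStructured P f R R') : IsCompact P.X := by
  have := FiniteDimensional.proper_real E
  exact Metric.isCompact_of_isClosed_isBounded h.closed_X
    (Metric.isBounded_iff.2 ⟨R, fun x hx y hy => by rw [dist_eq_norm]; exact h.diam_X x hx y hy⟩)

theorem isCompact_Y [FiniteDimensional ℝ E'] (h : IsMaxStructured P f R R') : IsCompact P.Y := by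
  have := FiniteDimensional.proper_real E'
  exact Metric.isCompact_of_isClosed_isBounded h.closed_Y
    (Metric.isBounded_iff.2 ⟨R', fun x hx y hy => by rw [dist_eq_norm]; exact h.diam_Y x hx y hy⟩)

theorem maxFun_eq (h : IsMaxStructured P f R R') {x : E} (hx : x ∈ P.X) :
    maxFun f P.Y x = f x (P.br x) := by
  refine IsGreatest.csSup_eq ⟨⟨_, h.br_mem x hx, rfl⟩, ?_⟩
  rintro _ ⟨y, hy, rfl⟩
  exact h.br_max x hx hy

theorem le_maxFun (h : IsMaxStructured P f R R') {x : E} (hx : x ∈ P.X) {y : E'} (hy : y ∈ P.Y) :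
    f x y ≤ maxFun f P.Y x := by
  rw [h.maxFun_eq hx]
  exact h.br_max x hx hy

theorem hasDerivWithinAt_line (h : IsMaxStructured P f R R') {x x' : E} {y y' : E'}
    (hx : x ∈ P.X) (hx' : x' ∈ P.X) (hy : y ∈ P.Y) (hy' : y' ∈ P.Y) {t : ℝ}
    (ht : t ∈ Set.Icc (0 : ℝ) 1) :
    HasDerivWithinAt (fun t : ℝ => f (x + t • (x' - x)) (y + t • (y' - y)))
      (⟪(P.grad (x + t • (x' - x)) (y + t • (y' - y))).1, x' - x⟫
        + ⟪(P.grad (x + t • (x' - x)) (y + t • (y' - y))).2, y' - y⟫) (Set.Icc 0 1) t := by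
  have h1 := h.hasGrad _ (h.convex_X.add_smul_sub_mem hx hx' ht) _
    (h.convex_Y.add_smul_sub_mem hy hy' ht)
  have hp : HasDerivWithinAt (fun t : ℝ => (x + t • (x' - x), y + t • (y' - y)))
      (x' - x, y' - y) (Set.Icc 0 1) t := by
    refine HasDerivAt.hasDerivWithinAt (HasDerivAt.prodMk ?_ ?_)
    · simpa using ((hasDerivAt_id t).smul_const (x' - x)).const_add x
    · simpa using ((hasDerivAt_id t).smul_const (y' - y)).const_add y
  have h2 := HasFDerivWithinAt.comp_hasDerivWithinAt (t := P.X ×ˢ P.Y) t h1 hp fun r hr =>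
    ⟨h.convex_X.add_smul_sub_mem hx hx' hr, h.convex_Y.add_smul_sub_mem hy hy' hr⟩
  simpa [Function.comp_def] using h2

theorem hasDerivWithinAt_fst (h : IsMaxStructured P f R R') {x x' : E} {y : E'}
    (hx : x ∈ P.X) (hx' : x' ∈ P.X) (hy : y ∈ P.Y) :
    HasDerivWithinAt (fun t : ℝ => f (x + t • (x' - x)) y) ⟪(P.grad x y).1, x' - x⟫
      (Set.Icc 0 1) 0 := by
  simpa using h.hasDerivWithinAt_line hx hx' hy hy (t := 0) (by simp)

theorem hasDerivWithinAt_snd (h : IsMaxStructured P f R R') {x : E} {y y' : E'}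
    (hx : x ∈ P.X) (hy : y ∈ P.Y) (hy' : y' ∈ P.Y) {t : ℝ} (ht : t ∈ Set.Icc (0 : ℝ) 1) :
    HasDerivWithinAt (fun t : ℝ => f x (y + t • (y' - y)))
      ⟪(P.grad x (y + t • (y' - y))).2, y' - y⟫ (Set.Icc 0 1) t := by
  simpa using h.hasDerivWithinAt_line hx hx hy hy' ht

theorem add_inner_le (h : IsMaxStructured P f R R') {x x' : E} {y : E'}
    (hx : x ∈ P.X) (hx' : x' ∈ P.X) (hy : y ∈ P.Y) :
    f x y + ⟪(P.grad x y).1, x' - x⟫ ≤ f x' y := by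
  have h1 : -(f x' y - f x y) ≤ -⟪(P.grad x y).1, x' - x⟫ := by
    refine le_of_hasDerivWithinAt_of_le (e := 0) (h.hasDerivWithinAt_fst hx hx' hy).neg
      fun t ht => ?_
    have h2 := (h.convex_x y hy).2 hx hx' (by linarith [ht.2] : 0 ≤ 1 - t) ht.1.le (by ring)
    have h3 : (1 - t) • x + t • x' = x + t • (x' - x) := by module
    rw [h3] at h2
    simp only [smul_eq_mul] at h2
    simp only [Pi.neg_apply, zero_smul, add_zero]
    linarith
  linarith

theorem le_add_inner_sub (h : IsMaxStructured P f R R') {x : E} {y y' : E'}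
    (hx : x ∈ P.X) (hy : y ∈ P.Y) (hy' : y' ∈ P.Y) :
    f x y' ≤ f x y + ⟪(P.grad x y).2, y' - y⟫ - P.μ / 2 * ‖y' - y‖ ^ 2 := by
  have h0 := h.hasDerivWithinAt_snd hx hy hy' (t := 0) (by simp)
  rw [zero_smul, add_zero] at h0
  have h1 : f x y' - f x y + P.μ / 2 * ‖y' - y‖ ^ 2 ≤ ⟪(P.grad x y).2, y' - y⟫ := by
    -- Strong concavity on a chord carries the factor t(1 - t); its t² part is the slack e, which
    -- vanishes in the limit.
    refine le_of_hasDerivWithinAt_of_le (e := P.μ / 2 * ‖y' - y‖ ^ 2) h0 fun t ht => ?_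
    have h2 := (h.concave_y x hx).2 hy hy' (by linarith [ht.2] : 0 ≤ 1 - t) ht.1.le (by ring)
    have h3 : (1 - t) • y + t • y' = y + t • (y' - y) := by module
    rw [h3, norm_sub_rev] at h2
    simp only [smul_eq_mul] at h2
    simp only [zero_smul, add_zero]
    linarith
  linarith

theorem norm_grad_snd_sub_le (h : IsMaxStructured P f R R') (hL : 0 ≤ P.L) {x : E} {y y' : E'}
    (hx : x ∈ P.X) (hy : y ∈ P.Y) (hy' : y' ∈ P.Y) :
    ‖(P.grad x y).2 - (P.grad x y').2‖ ≤ P.L * ‖y - y'‖ := by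
  have h1 := h.smooth x hx y hy x hx y' hy'
  rw [sub_self, norm_zero] at h1
  refine abs_le_of_sq_le_sq' ?_ (by positivity) |>.2
  nlinarith [sq_nonneg ‖(P.grad x y).1 - (P.grad x y').1‖]

theorem norm_grad_snd_sub_le' (h : IsMaxStructured P f R R') (hL : 0 ≤ P.L) {x x' : E} {y : E'}
    (hx : x ∈ P.X) (hx' : x' ∈ P.X) (hy : y ∈ P.Y) :
    ‖(P.grad x y).2 - (P.grad x' y).2‖ ≤ P.L * ‖x - x'‖ := by
  have h1 := h.smooth x hx y hy x' hx' y hy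
  rw [sub_self, norm_zero] at h1
  refine abs_le_of_sq_le_sq' ?_ (by positivity) |>.2
  nlinarith [sq_nonneg ‖(P.grad x y).1 - (P.grad x' y).1‖]

theorem add_inner_sub_le (h : IsMaxStructured P f R R') (hL : 0 ≤ P.L) {x : E} {y y' : E'}
    (hx : x ∈ P.X) (hy : y ∈ P.Y) (hy' : y' ∈ P.Y) :
    f x y + ⟪(P.grad x y).2, y' - y⟫ - P.L / 2 * ‖y' - y‖ ^ 2 ≤ f x y' := by
  set c := ⟪(P.grad x y).2, y' - y⟫ with hc
  -- Adding t²(L/2)‖y' - y‖² and removing the linear part makes the function monotone on [0, 1],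
  -- since the gradient moves by at most L t ‖y' - y‖.
  have hd : ∀ t ∈ Set.Icc (0 : ℝ) 1,
      HasDerivWithinAt (fun t : ℝ => f x (y + t • (y' - y)) - t * c + t ^ 2 * (P.L / 2 * ‖y' - y‖ ^ 2))
        (⟪(P.grad x (y + t • (y' - y))).2, y' - y⟫ - c + 2 * t * (P.L / 2 * ‖y' - y‖ ^ 2))
        (Set.Icc 0 1) t := fun t ht => by
    have h1 : HasDerivAt (fun t : ℝ => t * c) c t := by
      simpa using (hasDerivAt_id t).mul_const c
    have h2 : HasDerivAt (fun t : ℝ => t ^ 2 * (P.L / 2 * ‖y' - y‖ ^ 2))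
        (2 * t * (P.L / 2 * ‖y' - y‖ ^ 2)) t := by
      simpa using (hasDerivAt_pow 2 t).mul_const (P.L / 2 * ‖y' - y‖ ^ 2)
    exact ((h.hasDerivWithinAt_snd hx hy hy' ht).sub h1.hasDerivWithinAt).add
      h2.hasDerivWithinAt
  have hmono := monotoneOn_of_hasDerivWithinAt_nonneg (convex_Icc (0 : ℝ) 1)
    (fun t ht => (hd t ht).continuousWithinAt)
    (fun t ht => (hd t (interior_subset ht)).mono interior_subset) fun t ht => by
      rw [interior_Icc] at ht
      have hm := h.convex_Y.add_smul_sub_mem hy hy' ⟨ht.1.le, ht.2.le⟩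
      have h1 := h.norm_grad_snd_sub_le hL hx hm hy
      rw [add_sub_cancel_left, norm_smul, Real.norm_eq_abs, abs_of_pos ht.1] at h1
      have h2 := neg_le_of_abs_le (abs_real_inner_le_norm
        ((P.grad x (y + t • (y' - y))).2 - (P.grad x y).2) (y' - y))
      rw [inner_sub_left, ← hc] at h2
      nlinarith [mul_le_mul_of_nonneg_right h1 (norm_nonneg (y' - y))]
  have h3 := hmono (a := 0) (b := 1) (by simp) (by simp) zero_le_one
  simp only [zero_smul, add_zero, one_smul, add_sub_cancel] at h3
  linarith

theorem inner_br_le (h : IsMaxStructured P f R R') {x : E} (hx : x ∈ P.X) {y : E'}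
    (hy : y ∈ P.Y) : ⟪(P.grad x (P.br x)).2, y - P.br x⟫ ≤ 0 := by
  have hb := h.br_mem x hx
  have h0 := (h.hasDerivWithinAt_snd hx hb hy (t := 0) (by simp)).neg
  rw [zero_smul, add_zero] at h0
  have := le_of_hasDerivWithinAt_of_le (c := 0) (e := 0) h0 fun t ht => by
    have h1 : f x (P.br x + t • (y - P.br x)) ≤ f x (P.br x) := h.br_max x hx
      (h.convex_Y.add_smul_sub_mem hb hy ⟨ht.1.le, ht.2.le⟩)
    simp only [Pi.neg_apply, zero_smul, add_zero]
    linarith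
  linarith

theorem add_sq_le_maxFun (h : IsMaxStructured P f R R') {x : E} (hx : x ∈ P.X) {y : E'}
    (hy : y ∈ P.Y) : f x y + P.μ / 2 * ‖y - P.br x‖ ^ 2 ≤ maxFun f P.Y x := by
  rw [h.maxFun_eq hx]
  linarith [h.inner_br_le hx hy, h.le_add_inner_sub hx (h.br_mem x hx) hy]

/-- Best responses are `L / μ`-Lipschitz. -/
theorem norm_br_sub_le (h : IsMaxStructured P f R R') (hL : 0 ≤ P.L) {x x' : E}
    (hx : x ∈ P.X) (hx' : x' ∈ P.X) : P.μ * ‖P.br x - P.br x'‖ ≤ P.L * ‖x - x'‖ := by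
  have hb := h.br_mem x hx
  have hb' := h.br_mem x' hx'
  rcases (norm_nonneg (P.br x - P.br x')).eq_or_lt with h0 | hpos
  · rw [← h0, mul_zero]; positivity
  refine le_of_mul_le_mul_right ?_ hpos
  have h1 := h.inner_br_le hx' hb
  -- Strong concavity is used twice, here around the maximizer and in `h3` around `br x'`, to get
  -- the full modulus μ instead of μ/2.
  have h2 := h.add_sq_le_maxFun hx hb'
  rw [h.maxFun_eq hx] at h2
  have h3 := h.le_add_inner_sub hx hb' hb
  have h4 := h.norm_grad_snd_sub_le' hL hx hx' hb'
  have h5 := real_inner_le_norm ((P.grad x (P.br x')).2 - (P.grad x' (P.br x')).2)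
    (P.br x - P.br x')
  rw [inner_sub_left] at h5
  rw [norm_sub_rev (P.br x')] at h2
  nlinarith [mul_le_mul_of_nonneg_right h4 hpos.le]

end IsMaxStructured

/-- First-order optimality of `xs` for `F + (μ / 2) ‖· - s‖²` on `X`. -/
structure IsProxPoint (P : Access E E') (s xs : E) : Prop where
  mem : xs ∈ P.X
  inner_nonneg : ∀ u ∈ P.X, 0 ≤ ⟪(P.grad xs (P.br xs)).1 + P.μ • (xs - s), u - xs⟫

/-- The Bregman divergence from `xs` of the objective `F`, with the subgradient `μ (s - xs)`. -/
def divergence (P : Access E E') (f : E → E' → ℝ) (s xs u : E) : ℝ :=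
  maxFun f P.Y u - maxFun f P.Y xs - P.μ * ⟪s - xs, u - xs⟫

/-! ### Continuity of F, proximal points and the divergence. -/

namespace IsMaxStructured

variable {P : Access E E'} {f : E → E' → ℝ} {R R' : ℝ}

theorem continuousOn_maxFun (h : IsMaxStructured P f R R') (hμ : 0 < P.μ) (hL : 0 ≤ P.L) :
    ContinuousOn (maxFun f P.Y) P.X := by
  have hbr : ContinuousOn P.br P.X := by
    refine (LipschitzOnWith.of_dist_le_mul (K := (P.L / P.μ).toNNReal)
      fun x hx x' hx' => ?_).continuousOn
    rw [dist_eq_norm, dist_eq_norm, Real.coe_toNNReal _ (by positivity), div_mul_eq_mul_div, le_div_iff₀ hμ, mul_comm]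
    exact h.norm_br_sub_le hL hx hx'
  have hf : ContinuousOn (fun z : E × E' => f z.1 z.2) (P.X ×ˢ P.Y) := fun z hz =>
    (h.hasGrad z.1 hz.1 z.2 hz.2).continuousWithinAt
  have h1 : ContinuousOn (fun x => f x (P.br x)) P.X :=
    hf.comp (continuousOn_id.prodMk hbr) fun x hx => ⟨hx, h.br_mem x hx⟩
  exact h1.congr fun x hx => h.maxFun_eq hx

theorem exists_isMinOn_maxFun [FiniteDimensional ℝ E] (h : IsMaxStructured P f R R')
    (hμ : 0 < P.μ) (hL : 0 ≤ P.L) : ∃ xs ∈ P.X, IsMinOn (maxFun f P.Y) P.X xs :=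
  h.isCompact_X.exists_isMinOn h.nonempty_X (h.continuousOn_maxFun hμ hL)

theorem norm_grad_fst_sub_le (h : IsMaxStructured P f R R') (hL : 0 ≤ P.L) {x x' : E} {y y' : E'}
    (hx : x ∈ P.X) (hx' : x' ∈ P.X) (hy : y ∈ P.Y) (hy' : y' ∈ P.Y) :
    ‖(P.grad x y).1 - (P.grad x' y').1‖ ≤ P.L * (‖x - x'‖ + ‖y - y'‖) := by
  have h1 := h.smooth x hx y hy x' hx' y' hy'
  refine abs_le_of_sq_le_sq' ?_ (by positivity) |>.2
  have h2 : 0 ≤ P.L ^ 2 * (2 * (‖x - x'‖ * ‖y - y'‖)) := by positivity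
  nlinarith [sq_nonneg ‖(P.grad x y).2 - (P.grad x' y').2‖]

/-- A quantitative Danskin argument. A minimizer exists by compactness. Along a segment from it, F
at the moved point xt is attained at `br xt`, while F(xs) ≥ f(xs, br xt); convexity in x then bounds
the increase by the gradient at (xt, br xt), which differs from the one at (xs, br xs) by O(t). -/
theorem exists_isProxPoint [FiniteDimensional ℝ E] (h : IsMaxStructured P f R R')
    (hμ : 0 < P.μ) (hL : 0 ≤ P.L) (s : E) : ∃ xs, IsProxPoint P s xs := by
  obtain ⟨xs, hxs, hmin⟩ := h.isCompact_X.exists_isMinOn h.nonempty_X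
    (f := fun x => maxFun f P.Y x + P.μ / 2 * ‖x - s‖ ^ 2)
    ((h.continuousOn_maxFun hμ hL).add (by fun_prop))
  refine ⟨xs, hxs, fun u hu => ?_⟩
  set d := ‖u - xs‖ with hd
  -- L(1 + L/μ) is a Lipschitz constant of x ↦ ∇ₓf(x, br x); the other term comes from the
  -- regularizer.
  refine nonneg_of_forall_add_mul_nonneg (b := P.L * (1 + P.L / P.μ) * d ^ 2 + P.μ / 2 * d ^ 2)
    fun t ht => ?_
  have hxt : xs + t • (u - xs) ∈ P.X := h.convex_X.add_smul_sub_mem hxs hu ⟨ht.1.le, ht.2.le⟩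
  set xt := xs + t • (u - xs) with hxt_def
  have hdiff : xt - xs = t • (u - xs) := add_sub_cancel_left _ _
  have hnorm : ‖xt - xs‖ = t * d := by
    rw [hdiff, norm_smul, Real.norm_eq_abs, abs_of_pos ht.1]
  have hyt := h.br_mem xt hxt
  have hys := h.br_mem xs hxs
  have h1 : maxFun f P.Y xs + P.μ / 2 * ‖xs - s‖ ^ 2 ≤ maxFun f P.Y xt + P.μ / 2 * ‖xt - s‖ ^ 2 :=
    hmin hxt
  have h2 := h.le_maxFun hxs hyt
  rw [h.maxFun_eq hxt] at h1
  have h3 := h.add_inner_le hxt hxs hyt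
  rw [← neg_sub xt xs, inner_neg_right, hdiff, real_inner_smul_right] at h3
  have h4 := norm_sub_sq_add xt xs s
  rw [hnorm, hdiff, real_inner_smul_left] at h4
  have h5 := h.norm_grad_fst_sub_le hL hxt hxs hyt hys
  have h6 : ‖P.br xt - P.br xs‖ ≤ P.L / P.μ * (t * d) := by
    rw [div_mul_eq_mul_div, le_div_iff₀ hμ, mul_comm, ← hnorm]
    exact h.norm_br_sub_le hL hxt hxs
  have h7 := real_inner_le_norm ((P.grad xt (P.br xt)).1 - (P.grad xs (P.br xs)).1) (u - xs)
  rw [inner_sub_left, ← hd] at h7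
  have h8 : ‖(P.grad xt (P.br xt)).1 - (P.grad xs (P.br xs)).1‖ * d
      ≤ t * (P.L * (1 + P.L / P.μ) * d ^ 2) := by
    calc _ ≤ P.L * (t * d + P.L / P.μ * (t * d)) * d := by
          gcongr
          refine h5.trans ?_
          rw [hnorm]; gcongr
      _ = _ := by ring
  rw [inner_add_left, real_inner_smul_left, real_inner_comm (u - xs) (xs - s)]
  refine nonneg_of_mul_nonneg_right (a := t) ?_ ht.1
  have h9 : t * ⟪(P.grad xt (P.br xt)).1, u - xs⟫
      ≤ t * (⟪(P.grad xs (P.br xs)).1, u - xs⟫ + t * (P.L * (1 + P.L / P.μ) * d ^ 2)) :=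
    mul_le_mul_of_nonneg_left (by linarith) ht.1.le
  rw [h4] at h1
  linarith

/-- Since `br xs` is a suboptimal reply at u, strong concavity puts f(u, br xs) below F(u) by the
quadratic term. Linearizing f(·, br xs) at xs and using optimality of xs gives the rest. This is
what makes best-response initialization effective. -/
theorem br_sq_le_divergence (h : IsMaxStructured P f R R') {s xs u : E} (hp : IsProxPoint P s xs)
    (hu : u ∈ P.X) : P.μ / 2 * ‖P.br u - P.br xs‖ ^ 2 ≤ divergence P f s xs u := by
  have hys := h.br_mem xs hp.mem
  have h1 := h.add_sq_le_maxFun hu hys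
  have h2 := h.add_inner_le hp.mem hu hys
  have h3 := hp.inner_nonneg u hu
  rw [inner_add_left, real_inner_smul_left, ← neg_sub s xs, inner_neg_left] at h3
  rw [divergence, norm_sub_rev, h.maxFun_eq hp.mem]
  linarith

theorem divergence_nonneg (h : IsMaxStructured P f R R') (hμ : 0 < P.μ) {s xs u : E}
    (hp : IsProxPoint P s xs) (hu : u ∈ P.X) : 0 ≤ divergence P f s xs u :=
  le_trans (by positivity) (h.br_sq_le_divergence hp hu)

end IsMaxStructured

/-- Identifies the error measure with the suboptimality in the proximal problem, which is what a
saddle gap controls. -/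
theorem divergence_add_sq (P : Access E E') (f : E → E' → ℝ) (s xs u : E) :
    divergence P f s xs u + P.μ / 2 * ‖u - xs‖ ^ 2
      = (maxFun f P.Y u + P.μ / 2 * ‖u - s‖ ^ 2) - (maxFun f P.Y xs + P.μ / 2 * ‖xs - s‖ ^ 2) := by
  have h := norm_sub_sq_add u xs s
  rw [divergence, h, ← neg_sub xs s, inner_neg_left, real_inner_comm]
  ring

/-! ### Deterministic MirrorProx -/

/-- The gradient of `(x, y) ↦ f(x, y) + (μ / 2) ‖x - s‖²`. -/
def regOp (P : Access E E') (s x : E) (y : E') : E × E' :=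
  ((P.grad x y).1 + P.μ • (x - s), (P.grad x y).2)

/-- The intermediate point of an extragradient step. -/
def midPoint (X : Set E) (Y : Set E') (q : E → E' → E × E') (η : ℝ) (z : E × E') : E × E' :=
  (mirrorStep X z.1 (η • (q z.1 z.2).1), mirrorStep Y z.2 (-(η • (q z.1 z.2).2)))

/-- The extragradient update of `z` with the gradient taken at `m`. -/
def nextPoint (X : Set E) (Y : Set E') (q : E → E' → E × E') (η : ℝ) (z m : E × E') : E × E' :=
  (mirrorStep X z.1 (η • (q m.1 m.2).1), mirrorStep Y z.2 (-(η • (q m.1 m.2).2)))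

/-- One iteration of MirrorProx as a deterministic map. -/
def extragradStep (X : Set E) (Y : Set E') (q : E → E' → E × E') (η : ℝ)
    (S : (E × E') × (E × E')) : (E × E') × (E × E') :=
  (nextPoint X Y q η S.1 (midPoint X Y q η S.1), S.2 + midPoint X Y q η S.1)

/-- The output of MirrorProx as a deterministic map. -/
def extragrad (X : Set E) (Y : Set E') (q : E → E' → E × E') (ℓ : ℝ) (z₀ : E × E') (T : ℕ) :
    E × E' :=
  (T : ℝ)⁻¹ • ((extragradStep X Y q (1 / ℓ))^[T] (z₀, 0)).2

theorem extragradStep_iterate_snd (X : Set E) (Y : Set E') (q : E → E' → E × E') (η : ℝ)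
    (z₀ : E × E') (T : ℕ) :
    ((extragradStep X Y q η)^[T] (z₀, 0)).2
      = ∑ i ∈ Finset.range T, midPoint X Y q η ((extragradStep X Y q η)^[i] (z₀, 0)).1 := by
  induction T with
  | zero => simp
  | succ T ih =>
    rw [Finset.sum_range_succ, ← ih, Function.iterate_succ_apply']
    rfl

namespace IsMaxStructured

variable {P : Access E E'} {f : E → E' → ℝ} {R R' : ℝ}
  [FiniteDimensional ℝ E] [FiniteDimensional ℝ E']

theorem midPoint_mem (h : IsMaxStructured P f R R') (q : E → E' → E × E') (η : ℝ) (z : E × E') :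
    midPoint P.X P.Y q η z ∈ P.X ×ˢ P.Y :=
  ⟨mirrorStep_mem h.isCompact_X h.nonempty_X _ _, mirrorStep_mem h.isCompact_Y h.nonempty_Y _ _⟩

theorem nextPoint_mem (h : IsMaxStructured P f R R') (q : E → E' → E × E') (η : ℝ)
    (z m : E × E') : nextPoint P.X P.Y q η z m ∈ P.X ×ˢ P.Y :=
  ⟨mirrorStep_mem h.isCompact_X h.nonempty_X _ _, mirrorStep_mem h.isCompact_Y h.nonempty_Y _ _⟩

theorem extragradStep_iterate_mem (h : IsMaxStructured P f R R') (q : E → E' → E × E') (η : ℝ)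
    {z₀ : E × E'} (hz : z₀ ∈ P.X ×ˢ P.Y) (T : ℕ) :
    ((extragradStep P.X P.Y q η)^[T] (z₀, 0)).1 ∈ P.X ×ˢ P.Y := by
  cases T with
  | zero => exact hz
  | succ T =>
    rw [Function.iterate_succ_apply']
    exact h.nextPoint_mem _ _ _ _

omit [FiniteDimensional ℝ E] [FiniteDimensional ℝ E'] in
theorem regOp_lipschitz (h : IsMaxStructured P f R R') (hμ : 0 < P.μ) (hL : 0 < P.L) (s : E)
    {z w : E × E'} (hz : z ∈ P.X ×ˢ P.Y) (hw : w ∈ P.X ×ˢ P.Y) :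
    ‖(regOp P s z.1 z.2).1 - (regOp P s w.1 w.2).1‖ ^ 2
      + ‖(regOp P s z.1 z.2).2 - (regOp P s w.1 w.2).2‖ ^ 2
      ≤ (P.L + P.μ) ^ 2 * (‖z.1 - w.1‖ ^ 2 + ‖z.2 - w.2‖ ^ 2) := by
  have h1 := h.smooth z.1 hz.1 z.2 hz.2 w.1 hw.1 w.2 hw.2
  have h2 : (regOp P s z.1 z.2).1 - (regOp P s w.1 w.2).1
      = ((P.grad z.1 z.2).1 - (P.grad w.1 w.2).1) + P.μ • (z.1 - w.1) := by
    simp only [regOp]; module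
  have h3 : (regOp P s z.1 z.2).2 - (regOp P s w.1 w.2).2
      = (P.grad z.1 z.2).2 - (P.grad w.1 w.2).2 := rfl
  rw [h2, h3, norm_add_sq_real, real_inner_smul_right, norm_smul, Real.norm_eq_abs, mul_pow, sq_abs]
  set a := (P.grad z.1 z.2).1 - (P.grad w.1 w.2).1
  set b := (P.grad z.1 z.2).2 - (P.grad w.1 w.2).2
  have h4 := real_inner_le_norm a (z.1 - w.1)
  -- The cross term produced by the regularizer; AM-GM on ‖a‖ and L‖z.1 - w.1‖ bounds it without
  -- square roots.
  have h5 : ‖a‖ * ‖z.1 - w.1‖ ≤ P.L * (‖z.1 - w.1‖ ^ 2 + ‖z.2 - w.2‖ ^ 2) := by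
    have h6 : 0 ≤ (‖a‖ - P.L * ‖z.1 - w.1‖) ^ 2 := sq_nonneg _
    have h7 : P.L * (‖a‖ * ‖z.1 - w.1‖)
        ≤ P.L * (P.L * (‖z.1 - w.1‖ ^ 2 + ‖z.2 - w.2‖ ^ 2)) := by
      nlinarith [sq_nonneg ‖b‖, mul_nonneg (sq_nonneg P.L) (sq_nonneg ‖z.2 - w.2‖)]
    exact le_of_mul_le_mul_left h7 hL
  nlinarith [mul_le_mul_of_nonneg_left (h4.trans h5) hμ.le,
    mul_nonneg (sq_nonneg P.μ) (sq_nonneg ‖z.2 - w.2‖)]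

/-- One extragradient step for `φ(x, y) = f(x, y) + (μ / 2) ‖x - s‖²`. -/
theorem extragrad_step_le (h : IsMaxStructured P f R R') (hμ : 0 < P.μ) (hL : 0 < P.L) (s : E)
    {z w : E × E'} (hz : z ∈ P.X ×ˢ P.Y) (hw : w ∈ P.X ×ˢ P.Y) {m n : E × E'}
    (hm : m = midPoint P.X P.Y (regOp P s) (1 / (P.L + P.μ)) z)
    (hn : n = nextPoint P.X P.Y (regOp P s) (1 / (P.L + P.μ)) z m) :
    (f m.1 w.2 + P.μ / 2 * ‖m.1 - s‖ ^ 2) - (f w.1 m.2 + P.μ / 2 * ‖w.1 - s‖ ^ 2)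
      ≤ (P.L + P.μ) / 2 * ((‖w.1 - z.1‖ ^ 2 + ‖w.2 - z.2‖ ^ 2)
        - (‖w.1 - n.1‖ ^ 2 + ‖w.2 - n.2‖ ^ 2)) := by
  set ℓ := P.L + P.μ with hℓ
  have hℓ0 : 0 < ℓ := by positivity
  have hmm : m ∈ P.X ×ˢ P.Y := hm ▸ h.midPoint_mem _ _ _
  have hnm : n ∈ P.X ×ˢ P.Y := hn ▸ h.nextPoint_mem _ _ _ _
  set gz := regOp P s z.1 z.2 with hgz
  set gm := regOp P s m.1 m.2 with hgm
  have hm1 : m.1 = mirrorStep P.X z.1 ((1 / ℓ) • gz.1) := by rw [hm]; rfl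
  have hm2 : m.2 = mirrorStep P.Y z.2 (-((1 / ℓ) • gz.2)) := by rw [hm]; rfl
  have hn1 : n.1 = mirrorStep P.X z.1 ((1 / ℓ) • gm.1) := by rw [hn]; rfl
  have hn2 : n.2 = mirrorStep P.Y z.2 (-((1 / ℓ) • gm.2)) := by rw [hn]; rfl
  have a1 := mirrorStep_three_point h.isCompact_X h.convex_X z.1 ((1 / ℓ) • gz.1) hnm.1
  have a2 := mirrorStep_three_point h.isCompact_Y h.convex_Y z.2 (-((1 / ℓ) • gz.2)) hnm.2
  have a3 := mirrorStep_three_point h.isCompact_X h.convex_X z.1 ((1 / ℓ) • gm.1) hw.1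
  have a4 := mirrorStep_three_point h.isCompact_Y h.convex_Y z.2 (-((1 / ℓ) • gm.2)) hw.2
  rw [← hm1, real_inner_smul_left] at a1
  rw [← hm2, inner_neg_left, real_inner_smul_left] at a2
  rw [← hn1, real_inner_smul_left] at a3
  rw [← hn2, inner_neg_left, real_inner_smul_left] at a4
  have hlip : (1 / ℓ) ^ 2 * (‖gm.1 - gz.1‖ ^ 2 + ‖gm.2 - gz.2‖ ^ 2)
      ≤ ‖m.1 - z.1‖ ^ 2 + ‖m.2 - z.2‖ ^ 2 := by
    have := h.regOp_lipschitz hμ hL s hmm hz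
    rw [one_div, inv_pow, inv_mul_le_iff₀ (by positivity)]
    exact this
  -- Young's inequality for the error of using the gradient at z instead of m. With step 1/ℓ, `hlip`
  -- lets the negative terms ‖m - z‖² and ‖m - n‖² of `a1`, `a2` absorb it exactly.
  have b1 : 0 ≤ ‖(1 / ℓ) • (gm.1 - gz.1) - (m.1 - n.1)‖ ^ 2 := sq_nonneg _
  have b2 : 0 ≤ ‖(1 / ℓ) • (gm.2 - gz.2) + (m.2 - n.2)‖ ^ 2 := sq_nonneg _
  rw [norm_sub_sq_real, real_inner_smul_left, norm_smul, mul_pow, Real.norm_eq_abs, sq_abs,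
    inner_sub_left] at b1
  rw [norm_add_sq_real, real_inner_smul_left, norm_smul, mul_pow, Real.norm_eq_abs, sq_abs,
    inner_sub_left] at b2
  have c1 : ⟪gm.1, m.1 - w.1⟫ = ⟪gm.1, m.1 - n.1⟫ + ⟪gm.1, n.1 - w.1⟫ := by
    rw [← inner_add_right, sub_add_sub_cancel]
  have c2 : ⟪gm.2, m.2 - w.2⟫ = ⟪gm.2, m.2 - n.2⟫ + ⟪gm.2, n.2 - w.2⟫ := by
    rw [← inner_add_right, sub_add_sub_cancel]
  have key : (1 / ℓ) * (⟪gm.1, m.1 - w.1⟫ - ⟪gm.2, m.2 - w.2⟫)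
      ≤ 1 / 2 * ((‖w.1 - z.1‖ ^ 2 + ‖w.2 - z.2‖ ^ 2)
        - (‖w.1 - n.1‖ ^ 2 + ‖w.2 - n.2‖ ^ 2)) := by
    rw [c1, c2]
    rw [norm_sub_rev n.1 m.1] at a1
    rw [norm_sub_rev n.2 m.2] at a2
    linarith
  have d1 := h.add_inner_le hmm.1 hw.1 hmm.2
  have d2 := h.le_add_inner_sub hmm.1 hmm.2 hw.2
  have d3 := norm_sub_sq_add w.1 m.1 s
  have d4 : ⟪gm.1, m.1 - w.1⟫
      = -⟪(P.grad m.1 m.2).1, w.1 - m.1⟫ - P.μ * ⟪w.1 - m.1, m.1 - s⟫ := by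
    rw [← neg_sub w.1 m.1, inner_neg_right, hgm, regOp, inner_add_left, real_inner_smul_left,
      real_inner_comm (w.1 - m.1) (m.1 - s)]
    ring
  have d5 : ⟪gm.2, m.2 - w.2⟫ = -⟪(P.grad m.1 m.2).2, w.2 - m.2⟫ := by
    rw [← neg_sub w.2 m.2, inner_neg_right]; rfl
  rw [one_div, inv_mul_le_iff₀ hℓ0, d4, d5] at key
  have e1 : 0 ≤ P.μ / 2 * ‖w.1 - m.1‖ ^ 2 := by positivity
  have e2 : 0 ≤ P.μ / 2 * ‖w.2 - m.2‖ ^ 2 := by positivity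
  rw [d3]
  linarith

theorem extragrad_mem (h : IsMaxStructured P f R R') (q : E → E' → E × E') (ℓ : ℝ)
    (z₀ : E × E') {T : ℕ} (hT : 0 < T) : extragrad P.X P.Y q ℓ z₀ T ∈ P.X ×ˢ P.Y := by
  rw [extragrad, extragradStep_iterate_snd, Finset.smul_sum]
  refine (h.convex_X.prod h.convex_Y).sum_mem (fun _ _ => by positivity) ?_
    fun i _ => h.midPoint_mem _ _ _
  simp [hT.ne']

theorem extragrad_gap (h : IsMaxStructured P f R R') (hμ : 0 < P.μ) (hL : 0 < P.L) (s : E)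
    {z₀ w : E × E'} (hz : z₀ ∈ P.X ×ˢ P.Y) (hw : w ∈ P.X ×ˢ P.Y) {T : ℕ} (hT : 0 < T)
    {o : E × E'} (ho : o = extragrad P.X P.Y (regOp P s) (P.L + P.μ) z₀ T) :
    (f o.1 w.2 + P.μ / 2 * ‖o.1 - s‖ ^ 2) - (f w.1 o.2 + P.μ / 2 * ‖w.1 - s‖ ^ 2)
      ≤ (P.L + P.μ) / (2 * T) * (‖w.1 - z₀.1‖ ^ 2 + ‖w.2 - z₀.2‖ ^ 2) := by
  set η := 1 / (P.L + P.μ) with hη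
  set Z : ℕ → E × E' := fun i => ((extragradStep P.X P.Y (regOp P s) η)^[i] (z₀, 0)).1 with hZ
  set m : ℕ → E × E' := fun i => midPoint P.X P.Y (regOp P s) η (Z i) with hm
  have hZm : ∀ i, Z i ∈ P.X ×ˢ P.Y := h.extragradStep_iterate_mem _ _ hz
  have hmm : ∀ i, m i ∈ P.X ×ˢ P.Y := fun i => h.midPoint_mem _ _ _
  have hT' : (0 : ℝ) < T := by exact_mod_cast hT
  have ho' : o = ∑ i ∈ Finset.range T, (T : ℝ)⁻¹ • m i := by
    rw [ho, extragrad, extragradStep_iterate_snd, Finset.smul_sum]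
  have ho1 : o.1 = ∑ i ∈ Finset.range T, (T : ℝ)⁻¹ • (m i).1 := by rw [ho', Prod.fst_sum]; rfl
  have ho2 : o.2 = ∑ i ∈ Finset.range T, (T : ℝ)⁻¹ • (m i).2 := by rw [ho', Prod.snd_sum]; rfl
  have hsum : ∑ i ∈ Finset.range T, ((f (m i).1 w.2 + P.μ / 2 * ‖(m i).1 - s‖ ^ 2)
      - (f w.1 (m i).2 + P.μ / 2 * ‖w.1 - s‖ ^ 2))
      ≤ (P.L + P.μ) / 2 * (‖w.1 - z₀.1‖ ^ 2 + ‖w.2 - z₀.2‖ ^ 2) := by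
    have hstep : ∀ i ∈ Finset.range T, ((f (m i).1 w.2 + P.μ / 2 * ‖(m i).1 - s‖ ^ 2)
        - (f w.1 (m i).2 + P.μ / 2 * ‖w.1 - s‖ ^ 2))
        ≤ (P.L + P.μ) / 2 * (‖w.1 - (Z i).1‖ ^ 2 + ‖w.2 - (Z i).2‖ ^ 2)
          - (P.L + P.μ) / 2 * (‖w.1 - (Z (i + 1)).1‖ ^ 2 + ‖w.2 - (Z (i + 1)).2‖ ^ 2) :=
      fun i _ => by
        rw [← mul_sub]
        refine h.extragrad_step_le hμ hL s (hZm i) hw rfl ?_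
        simp only [hZ, Function.iterate_succ_apply']
        rfl
    refine (Finset.sum_le_sum hstep).trans ?_
    rw [Finset.sum_range_sub']
    have h0 : 0 ≤ (P.L + P.μ) / 2 * (‖w.1 - (Z T).1‖ ^ 2 + ‖w.2 - (Z T).2‖ ^ 2) := by positivity
    have h1 : Z 0 = z₀ := rfl
    rw [h1]
    linarith
  have hw1 : ∑ _i ∈ Finset.range T, (T : ℝ)⁻¹ = 1 := by simp [hT.ne']
  have hsq : ConvexOn ℝ P.X fun x => P.μ / 2 * ‖x - s‖ ^ 2 := by
    have h1 : ConvexOn ℝ Set.univ fun x : E => ‖x - s‖ ^ 2 := by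
      have h2 := (convexOn_univ_norm (E := E)).translate_right (-s)
      have h3 : ConvexOn ℝ Set.univ fun x : E => ‖x - s‖ := by
        simpa [Function.comp_def, sub_eq_neg_add] using h2
      exact h3.pow (fun x _ => norm_nonneg _) 2
    exact (h1.subset (Set.subset_univ _) h.convex_X).smul (by positivity : 0 ≤ P.μ / 2)
  have hj1 := ((h.convex_x w.2 hw.2).add hsq).map_sum_le (t := Finset.range T)
    (w := fun _ => (T : ℝ)⁻¹) (p := fun i => (m i).1) (fun _ _ => by positivity) hw1
    fun i _ => (hmm i).1
  have hconc : ConcaveOn ℝ P.Y (f w.1) := (h.concave_y w.1 hw.1).concaveOn (fun r => by positivity)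
  have hj2 := hconc.le_map_sum (t := Finset.range T)
    (w := fun _ => (T : ℝ)⁻¹) (p := fun i => (m i).2) (fun _ _ => by positivity) hw1
    fun i _ => (hmm i).2
  rw [← ho1] at hj1
  rw [← ho2] at hj2
  simp only [Pi.add_apply, smul_eq_mul, ← Finset.mul_sum] at hj1 hj2
  rw [Finset.sum_sub_distrib, Finset.sum_add_distrib (f := fun i => f w.1 (m i).2),
    Finset.sum_const, Finset.card_range, nsmul_eq_mul] at hsum
  have h5 := mul_le_mul_of_nonneg_left hsum (inv_nonneg.2 hT'.le)
  have h6 : (T : ℝ)⁻¹ * ((T : ℝ) * (P.μ / 2 * ‖w.1 - s‖ ^ 2)) = P.μ / 2 * ‖w.1 - s‖ ^ 2 := by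
    field_simp
  have h7 : (P.L + P.μ) / (2 * T) * (‖w.1 - z₀.1‖ ^ 2 + ‖w.2 - z₀.2‖ ^ 2)
      = (T : ℝ)⁻¹ * ((P.L + P.μ) / 2 * (‖w.1 - z₀.1‖ ^ 2 + ‖w.2 - z₀.2‖ ^ 2)) := by
    field_simp
  rw [h7]
  rw [mul_sub, mul_add, h6] at h5
  linarith

/-- With `M ≥ 80 L / μ` iterations, MirrorProx contracts the divergence from the proximal point. -/
theorem divergence_extragrad_le (h : IsMaxStructured P f R R') (hμ : 0 < P.μ) (hμL : P.μ ≤ P.L)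
    {s xs : E} (hp : IsProxPoint P s xs) {z₀ : E × E'} (hz : z₀ ∈ P.X ×ˢ P.Y) {M : ℕ}
    (hM : 80 * P.L ≤ P.μ * M) {o : E × E'}
    (ho : o = extragrad P.X P.Y (regOp P s) (P.L + P.μ) z₀ M) :
    divergence P f s xs o.1 + P.μ / 2 * ‖o.1 - xs‖ ^ 2
      ≤ 1 / 16 * (P.μ / 2 * ‖xs - z₀.1‖ ^ 2 + P.μ / 2 * ‖P.br xs - z₀.2‖ ^ 2) := by
  have hL : 0 < P.L := hμ.trans_le hμL
  have hM0 : 0 < M := by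
    rcases Nat.eq_zero_or_pos M with rfl | h0
    · simp only [Nat.cast_zero, mul_zero] at hM; linarith
    · exact h0
  have hM' : (0 : ℝ) < M := by exact_mod_cast hM0
  have hom : o ∈ P.X ×ˢ P.Y := ho ▸ h.extragrad_mem _ _ _ hM0
  have hbo := h.br_mem _ hom.1
  -- The dual comparator is the best response to the output itself, which turns the gap into a bound
  -- on F(o.1).
  have h1 := h.extragrad_gap hμ hL s hz (w := (xs, P.br o.1)) ⟨hp.mem, hbo⟩ hM0 ho
  simp only at h1
  rw [← h.maxFun_eq hom.1] at h1
  have h2 := h.le_maxFun hp.mem hom.2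
  have h3 : (P.L + P.μ) / (2 * M) ≤ 1 / 40 * (P.μ / 2) := by
    rw [div_le_iff₀ (by positivity)]; linarith
  have h4 := mul_le_mul_of_nonneg_right h3
    (by positivity : 0 ≤ ‖xs - z₀.1‖ ^ 2 + ‖P.br o.1 - z₀.2‖ ^ 2)
  -- The comparator depends on the output, so its distance to `br xs` is charged to the divergence
  -- on the left. This costs 1/20 of it and leaves the factor (1/20)/(19/20) = 1/19 ≤ 1/16.
  have h5 := norm_sub_sq_le_two_mul (P.br o.1) (P.br xs) z₀.2
  have h6 := h.br_sq_le_divergence hp hom.1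
  have h7 := divergence_add_sq P f s xs o.1
  have h8 : 0 ≤ P.μ / 2 * ‖xs - z₀.1‖ ^ 2 := by positivity
  have h9 : 0 ≤ P.μ / 2 * ‖P.br xs - z₀.2‖ ^ 2 := by positivity
  have h10 : 0 ≤ P.μ / 2 * ‖o.1 - xs‖ ^ 2 := by positivity
  have h11 := mul_le_mul_of_nonneg_left h5 (by positivity : 0 ≤ P.μ / 2)
  linarith

/-- With `M ≥ 80 L / μ` iterations, MirrorProx contracts the distance to the saddle point. -/
theorem dist_extragrad_le (h : IsMaxStructured P f R R') (hμ : 0 < P.μ) (hμL : P.μ ≤ P.L)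
    {s xs : E} (hp : IsProxPoint P s xs) {z₀ : E × E'} (hz : z₀ ∈ P.X ×ˢ P.Y) {M : ℕ}
    (hM : 80 * P.L ≤ P.μ * M) {o : E × E'}
    (ho : o = extragrad P.X P.Y (regOp P s) (P.L + P.μ) z₀ M) :
    ‖xs - o.1‖ ^ 2 + ‖P.br xs - o.2‖ ^ 2
      ≤ 1 / 40 * (‖xs - z₀.1‖ ^ 2 + ‖P.br xs - z₀.2‖ ^ 2) := by
  have hL : 0 < P.L := hμ.trans_le hμL
  have hM0 : 0 < M := by
    rcases Nat.eq_zero_or_pos M with rfl | h0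
    · simp only [Nat.cast_zero, mul_zero] at hM; linarith
    · exact h0
  have hM' : (0 : ℝ) < M := by exact_mod_cast hM0
  have hom : o ∈ P.X ×ˢ P.Y := ho ▸ h.extragrad_mem _ _ _ hM0
  have hys := h.br_mem _ hp.mem
  -- Here the comparator is the saddle point, where the gap dominates (μ/2) times the squared
  -- distance in both variables.
  have h1 := h.extragrad_gap hμ hL s hz (w := (xs, P.br xs)) ⟨hp.mem, hys⟩ hM0 ho
  simp only at h1
  have h3 : (P.L + P.μ) / (2 * M) ≤ 1 / 40 * (P.μ / 2) := by
    rw [div_le_iff₀ (by positivity)]; linarith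
  have h4 := mul_le_mul_of_nonneg_right h3
    (by positivity : 0 ≤ ‖xs - z₀.1‖ ^ 2 + ‖P.br xs - z₀.2‖ ^ 2)
  have h5 := h.add_sq_le_maxFun hp.mem hom.2
  rw [h.maxFun_eq hp.mem] at h5
  have h6 := h.add_inner_le hp.mem hom.1 hys
  have h7 := hp.inner_nonneg _ hom.1
  have h8 := norm_sub_sq_add o.1 xs s
  rw [inner_add_left, real_inner_smul_left, real_inner_comm (o.1 - xs) (xs - s)] at h7
  rw [norm_sub_rev xs o.1, norm_sub_rev (P.br xs) o.2]
  have h9 : P.μ / 2 * (‖o.1 - xs‖ ^ 2 + ‖o.2 - P.br xs‖ ^ 2)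
      ≤ P.μ / 2 * (1 / 40 * (‖xs - z₀.1‖ ^ 2 + ‖P.br xs - z₀.2‖ ^ 2)) := by
    rw [h8] at h1
    linarith
  exact le_of_mul_le_mul_left h9 (by positivity)

end IsMaxStructured

/-! ### Deterministic accelerated gradient ascent -/

/-- The point at which an accelerated step queries the gradient. -/
def agdPoint (P : Access E E') (S : E' × E') : E' :=
  (1 + Real.sqrt (P.μ / P.L))⁻¹ • (S.1 + Real.sqrt (P.μ / P.L) • S.2)

/-- The update of the second component of the state in an accelerated step. -/
def agdDual (P : Access E E') (x : E) (S : E' × E') : E' :=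
  mirrorStep P.Y ((1 - Real.sqrt (P.μ / P.L)) • S.2 + Real.sqrt (P.μ / P.L) • agdPoint P S)
    (-((Real.sqrt (P.μ / P.L) / P.μ) • (P.grad x (agdPoint P S)).2))

/-- One accelerated step as a deterministic map. -/
def agdMap (P : Access E E') (x : E) (S : E' × E') : E' × E' :=
  ((1 - Real.sqrt (P.μ / P.L)) • S.1 + Real.sqrt (P.μ / P.L) • agdDual P x S, agdDual P x S)

/-- The projected gradient step which starts accelerated gradient ascent. -/
def agdInit (P : Access E E') (x : E) (y₀ : E') : E' :=
  mirrorStep P.Y y₀ (-((1 / P.L) • (P.grad x y₀).2))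

/-- The output of accelerated gradient ascent. -/
def agdOut (P : Access E E') (x : E) (y₀ : E') (N : ℕ) : E' :=
  ((agdMap P x)^[N] (agdInit P x y₀, agdInit P x y₀)).1

/-- The output of WarmStart given the output `y` of its gradient ascent phase. -/
def warmOut (P : Access E E') (s : E) (y : E') (T K : ℕ) : E × E' :=
  (fun z => extragrad P.X P.Y (regOp P s) (P.L + P.μ) z T)^[K] (s, y)

namespace IsMaxStructured

variable {P : Access E E'} {f : E → E' → ℝ} {R R' : ℝ}

section AGD

variable [FiniteDimensional ℝ E']

theorem agdInit_mem (h : IsMaxStructured P f R R') (x : E) (y₀ : E') : agdInit P x y₀ ∈ P.Y :=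
  mirrorStep_mem h.isCompact_Y h.nonempty_Y _ _

theorem agdDual_mem (h : IsMaxStructured P f R R') (x : E) (S : E' × E') :
    agdDual P x S ∈ P.Y :=
  mirrorStep_mem h.isCompact_Y h.nonempty_Y _ _

/-- With step 1/L the prox term cancels the smoothness error, leaving only (L/2)‖br x - y₀‖². This
bounds the initial Lyapunov function by L R'²/2. -/
theorem agdInit_le (h : IsMaxStructured P f R R') (hμ : 0 < P.μ) (hL : 0 < P.L) {x : E}
    (hx : x ∈ P.X) {y₀ : E'} (hy : y₀ ∈ P.Y) :
    maxFun f P.Y x - f x (agdInit P x y₀) + P.L / 2 * ‖P.br x - agdInit P x y₀‖ ^ 2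
      ≤ P.L * R' ^ 2 / 2 := by
  have hb := h.br_mem x hx
  have h1 := mirrorStep_three_point h.isCompact_Y h.convex_Y y₀
    (-((1 / P.L) • (P.grad x y₀).2)) hb
  have hm := h.agdInit_mem x y₀
  change ⟪_, agdInit P x y₀ - P.br x⟫ ≤ _ - ‖P.br x - agdInit P x y₀‖ ^ 2 / 2
    - ‖agdInit P x y₀ - y₀‖ ^ 2 / 2 at h1
  set y := agdInit P x y₀
  set g := (P.grad x y₀).2
  rw [inner_neg_left, real_inner_smul_left, ← mul_neg, one_div, inv_mul_le_iff₀ hL] at h1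
  have h2 := h.add_inner_sub_le hL.le hx hy hm
  have h3 := h.le_add_inner_sub hx hy hb
  have h4 : ⟪g, y - P.br x⟫ = ⟪g, y - y₀⟫ - ⟪g, P.br x - y₀⟫ := by
    rw [← inner_sub_right, sub_sub_sub_cancel_right]
  have h5 : ‖P.br x - y₀‖ ≤ R' := h.diam_Y _ hb _ hy
  have h6 : ‖P.br x - y₀‖ ^ 2 ≤ R' ^ 2 := by gcongr
  have h7 := mul_le_mul_of_nonneg_left h6 hL.le
  have h8 : 0 ≤ P.μ / 2 * ‖P.br x - y₀‖ ^ 2 := by positivity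
  rw [h.maxFun_eq hx]
  rw [h4] at h1
  linarith

/-- The Lyapunov function is the dual gap at the first component plus (μ/2) times the squared
distance of the second to the maximizer. The choice θ² = μ/L balances smoothness against the prox
step. -/
theorem agdMap_le (h : IsMaxStructured P f R R') (hμ : 0 < P.μ) (hμL : P.μ ≤ P.L) {x : E}
    (hx : x ∈ P.X) {S : E' × E'} (hS : S ∈ P.Y ×ˢ P.Y) :
    agdMap P x S ∈ P.Y ×ˢ P.Y ∧
      maxFun f P.Y x - f x (agdMap P x S).1 + P.μ / 2 * ‖P.br x - (agdMap P x S).2‖ ^ 2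
        ≤ (1 - Real.sqrt (P.μ / P.L))
          * (maxFun f P.Y x - f x S.1 + P.μ / 2 * ‖P.br x - S.2‖ ^ 2) := by
  have hL : 0 < P.L := hμ.trans_le hμL
  obtain ⟨y, z⟩ := S
  obtain ⟨hy, hz⟩ := hS
  simp only at hy hz
  have hb := h.br_mem x hx
  have hwdef : agdPoint P (y, z)
      = (1 + Real.sqrt (P.μ / P.L))⁻¹ • (y + Real.sqrt (P.μ / P.L) • z) := rfl
  have hz' := h.agdDual_mem x (y, z)
  have h3p := mirrorStep_three_point h.isCompact_Y h.convex_Y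
    ((1 - Real.sqrt (P.μ / P.L)) • z + Real.sqrt (P.μ / P.L) • agdPoint P (y, z))
    (-((Real.sqrt (P.μ / P.L) / P.μ) • (P.grad x (agdPoint P (y, z))).2)) hb
  have hdual : mirrorStep P.Y
      ((1 - Real.sqrt (P.μ / P.L)) • z + Real.sqrt (P.μ / P.L) • agdPoint P (y, z))
      (-((Real.sqrt (P.μ / P.L) / P.μ) • (P.grad x (agdPoint P (y, z))).2))
      = agdDual P x (y, z) := rfl
  rw [hdual] at h3p
  simp only [agdMap]
  set θ := Real.sqrt (P.μ / P.L) with hθ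
  have hθ0 : 0 < θ := Real.sqrt_pos.2 (by positivity)
  have hθ1 : θ ≤ 1 := Real.sqrt_le_one.2 ((div_le_one hL).2 hμL)
  have hθsq : P.L * θ ^ 2 = P.μ := by
    rw [hθ, Real.sq_sqrt (by positivity)]; field_simp
  set w := agdPoint P (y, z)
  set z' := agdDual P x (y, z)
  set g := (P.grad x w).2
  have hw : w ∈ P.Y := by
    have := h.convex_Y hy hz (a := (1 + θ)⁻¹) (b := (1 + θ)⁻¹ * θ) (by positivity) (by positivity)
      (by field_simp)
    rwa [hwdef, smul_add, smul_smul]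
  have hw' : y + θ • z = (1 + θ) • w := by
    rw [hwdef, smul_smul, mul_inv_cancel₀ (by positivity), one_smul]
  have hy' : (1 - θ) • y + θ • z' ∈ P.Y :=
    h.convex_Y hy hz' (by linarith) hθ0.le (by ring)
  refine ⟨⟨hy', hz'⟩, ?_⟩
  -- The defining property of w: the displacement of the new y is θ times that of z' from its prox
  -- centre.
  have hyw : (1 - θ) • y + θ • z' - w = θ • (z' - ((1 - θ) • z + θ • w)) := by
    have : y = (1 + θ) • w - θ • z := eq_sub_of_add_eq hw'
    rw [this]; module
  have h1 := h.add_inner_sub_le hL.le hx hw hy'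
  have h2 : ⟪g, (1 - θ) • y + θ • z' - w⟫ = (1 - θ) * ⟪g, y - w⟫ + θ * ⟪g, z' - w⟫ := by
    rw [← real_inner_smul_right, ← real_inner_smul_right, ← inner_add_right]
    congr 1; module
  rw [h2, hyw, norm_smul, Real.norm_eq_abs, mul_pow, sq_abs] at h1
  have h4 := h.le_add_inner_sub hx hw hy
  have h5 := h.le_add_inner_sub hx hw hb
  rw [inner_neg_left, real_inner_smul_left, ← mul_neg, div_mul_eq_mul_div,
    div_le_iff₀ hμ] at h3p
  have h6 : ‖P.br x - ((1 - θ) • z + θ • w)‖ ^ 2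
      ≤ (1 - θ) * ‖P.br x - z‖ ^ 2 + θ * ‖P.br x - w‖ ^ 2 := by
    have e1 : P.br x - ((1 - θ) • z + θ • w) = (1 - θ) • (P.br x - z) + θ • (P.br x - w) := by
      module
    have e2 : ‖(1 - θ) • (P.br x - z) + θ • (P.br x - w)‖
        ≤ (1 - θ) * ‖P.br x - z‖ + θ * ‖P.br x - w‖ := by
      refine (norm_add_le _ _).trans_eq ?_
      rw [norm_smul, norm_smul, Real.norm_eq_abs, Real.norm_eq_abs,
        abs_of_nonneg (sub_nonneg.2 hθ1), abs_of_pos hθ0]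
    rw [e1]
    have e3 := pow_le_pow_left₀ (norm_nonneg _) e2 2
    nlinarith [mul_nonneg (mul_nonneg hθ0.le (sub_nonneg.2 hθ1))
      (sq_nonneg (‖P.br x - z‖ - ‖P.br x - w‖))]
  have h7 : ⟪g, z' - P.br x⟫ = ⟪g, z' - w⟫ - ⟪g, P.br x - w⟫ := by
    rw [← inner_sub_right, sub_sub_sub_cancel_right]
  rw [h7] at h3p
  rw [h.maxFun_eq hx]
  -- Lθ² = μ, so the smoothness error equals the negative prox term in `h3p` and cancels.
  have h8 : P.L / 2 * (θ ^ 2 * ‖z' - ((1 - θ) • z + θ • w)‖ ^ 2)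
      = P.μ / 2 * ‖z' - ((1 - θ) • z + θ • w)‖ ^ 2 := by rw [← hθsq]; ring
  have h9 := mul_le_mul_of_nonneg_left h4 (sub_nonneg.2 hθ1)
  have h10 := mul_le_mul_of_nonneg_left h5 hθ0.le
  have h11 := mul_le_mul_of_nonneg_left h6 hμ.le
  have h12 : 0 ≤ (1 - θ) * (P.μ / 2 * ‖y - w‖ ^ 2) :=
    mul_nonneg (sub_nonneg.2 hθ1) (by positivity)
  linarith

theorem agdOut_spec (h : IsMaxStructured P f R R') (hμ : 0 < P.μ) (hμL : P.μ ≤ P.L) {x : E}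
    (hx : x ∈ P.X) {y₀ : E'} (hy : y₀ ∈ P.Y) (N : ℕ) :
    agdOut P x y₀ N ∈ P.Y ∧ maxFun f P.Y x - f x (agdOut P x y₀ N)
      ≤ (1 - Real.sqrt (P.μ / P.L)) ^ N * (P.L * R' ^ 2 / 2) := by
  have hL : 0 < P.L := hμ.trans_le hμL
  have hθ1 : Real.sqrt (P.μ / P.L) ≤ 1 := Real.sqrt_le_one.2 ((div_le_one hL).2 hμL)
  suffices H : ∀ N, (agdMap P x)^[N] (agdInit P x y₀, agdInit P x y₀) ∈ P.Y ×ˢ P.Y ∧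
      maxFun f P.Y x - f x ((agdMap P x)^[N] (agdInit P x y₀, agdInit P x y₀)).1
        + P.μ / 2 * ‖P.br x - ((agdMap P x)^[N] (agdInit P x y₀, agdInit P x y₀)).2‖ ^ 2
      ≤ (1 - Real.sqrt (P.μ / P.L)) ^ N * (P.L * R' ^ 2 / 2) by
    obtain ⟨h1, h2⟩ := H N
    refine ⟨h1.1, le_trans ?_ h2⟩
    have : 0 ≤ P.μ / 2
      * ‖P.br x - ((agdMap P x)^[N] (agdInit P x y₀, agdInit P x y₀)).2‖ ^ 2 := by positivity
    rw [agdOut]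
    linarith
  intro N
  induction N with
  | zero =>
    have hi := h.agdInit_mem x y₀
    refine ⟨⟨hi, hi⟩, ?_⟩
    have h1 := h.agdInit_le hμ hL hx hy
    have h2 : P.μ / 2 * ‖P.br x - agdInit P x y₀‖ ^ 2
        ≤ P.L / 2 * ‖P.br x - agdInit P x y₀‖ ^ 2 := by gcongr
    simp only [Function.iterate_zero, id, pow_zero, one_mul]
    linarith
  | succ N ih =>
    rw [Function.iterate_succ_apply']
    obtain ⟨h1, h2⟩ := h.agdMap_le hμ hμL hx ih.1
    refine ⟨h1, h2.trans ?_⟩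
    rw [pow_succ' _ N, mul_assoc]
    exact mul_le_mul_of_nonneg_left ih.2 (sub_nonneg.2 hθ1)

theorem agdOut_le (h : IsMaxStructured P f R R') (hμ : 0 < P.μ) (hμL : P.μ ≤ P.L) (hR : 0 < R)
    (hR' : 0 < R') {x : E} (hx : x ∈ P.X) {y₀ : E'} (hy : y₀ ∈ P.Y) {N : ℕ}
    (hN : 2 * (Real.sqrt (P.L / P.μ) * Real.posLog (R' / R)) ≤ N) :
    maxFun f P.Y x - f x (agdOut P x y₀ N) ≤ P.L * R ^ 2 / 2 := by
  have hL : 0 < P.L := hμ.trans_le hμL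
  refine (h.agdOut_spec hμ hμL hx hy N).2.trans ?_
  have hθ1 : Real.sqrt (P.μ / P.L) ≤ 1 := Real.sqrt_le_one.2 ((div_le_one hL).2 hμL)
  have hθ0 : 0 < Real.sqrt (P.μ / P.L) := Real.sqrt_pos.2 (by positivity)
  have h1 : Real.sqrt (P.μ / P.L) * Real.sqrt (P.L / P.μ) = 1 := by
    rw [← Real.sqrt_mul (by positivity), div_mul_div_cancel₀ hL.ne', div_self hμ.ne',
      Real.sqrt_one]
  have h2 : (1 - Real.sqrt (P.μ / P.L)) ^ N ≤ (R / R') ^ 2 := by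
    have e1 : (1 - Real.sqrt (P.μ / P.L)) ^ N ≤ Real.exp (-Real.sqrt (P.μ / P.L)) ^ N :=
      pow_le_pow_left₀ (sub_nonneg.2 hθ1) (Real.one_sub_le_exp_neg _) N
    refine e1.trans ?_
    rw [← Real.exp_nat_mul, ← Real.le_log_iff_exp_le (by positivity), Real.log_pow,
      ← inv_div R' R, Real.log_inv]
    have e2 := mul_le_mul_of_nonneg_left hN hθ0.le
    have e3 : Real.log (R' / R) ≤ Real.posLog (R' / R) := le_max_right _ _
    have e4 : Real.sqrt (P.μ / P.L) * (2 * (Real.sqrt (P.L / P.μ) * Real.posLog (R' / R)))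
        = 2 * Real.posLog (R' / R) := by linear_combination (2 * Real.posLog (R' / R)) * h1
    push_cast
    linarith
  calc _ ≤ (R / R') ^ 2 * (P.L * R' ^ 2 / 2) := by gcongr
    _ = _ := by field_simp

end AGD

/-! ### The warm start. -/

variable [FiniteDimensional ℝ E] [FiniteDimensional ℝ E']

theorem warmOut_mem (h : IsMaxStructured P f R R') {s : E} (hs : s ∈ P.X) {y : E'} (hy : y ∈ P.Y)
    {T : ℕ} (hT : 0 < T) (K : ℕ) : warmOut P s y T K ∈ P.X ×ˢ P.Y := by
  cases K with
  | zero => exact ⟨hs, hy⟩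
  | succ K =>
    rw [warmOut, Function.iterate_succ_apply']
    exact h.extragrad_mem _ _ _ hT

/-- The first n epochs contract the distance to the saddle point of the problem centred at s; one
more epoch converts distance into function value. The regularizer costs (μ/2)R², and the last epoch
(5/32)μR². -/
theorem maxFun_warmOut_le (h : IsMaxStructured P f R R') (hμ : 0 < P.μ) (hμL : P.μ ≤ P.L)
    {s : E} (hs : s ∈ P.X) {y : E'} (hy : y ∈ P.Y)
    (hgap : maxFun f P.Y s - f s y ≤ P.L * R ^ 2 / 2) {M n : ℕ} (hM : 80 * P.L ≤ P.μ * M)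
    (hn : (1 / 40 : ℝ) ^ n * (P.L / P.μ) ^ 2 ≤ 1) {z : E} (hz : z ∈ P.X) :
    maxFun f P.Y (warmOut P s y M (n + 1)).1 - maxFun f P.Y z ≤ 3 / 4 * (P.μ * R ^ 2) := by
  have hL : 0 < P.L := hμ.trans_le hμL
  have hM0 : 0 < M := by
    rcases Nat.eq_zero_or_pos M with rfl | h0
    · simp only [Nat.cast_zero, mul_zero] at hM; linarith
    · exact h0
  obtain ⟨xs, hp⟩ := h.exists_isProxPoint hμ hL.le s
  set κ := P.L / P.μ with hκ
  have hκ1 : 1 ≤ κ := (one_le_div hμ).2 hμL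
  have hdist : ∀ n, ‖xs - (warmOut P s y M n).1‖ ^ 2 + ‖P.br xs - (warmOut P s y M n).2‖ ^ 2
      ≤ (1 / 40) ^ n * (‖xs - s‖ ^ 2 + ‖P.br xs - y‖ ^ 2) := by
    intro n
    induction n with
    | zero => simp [warmOut]
    | succ n ih =>
      have h1 := h.dist_extragrad_le hμ hμL hp (h.warmOut_mem hs hy hM0 n) hM rfl
      rw [warmOut, Function.iterate_succ_apply', pow_succ' _ n, mul_assoc]
      exact h1.trans (mul_le_mul_of_nonneg_left ih (by norm_num))
  have hx0 : ‖xs - s‖ ^ 2 ≤ R ^ 2 := by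
    have := h.diam_X _ hp.mem _ hs
    gcongr
  have hb : ‖P.br xs - P.br s‖ ^ 2 ≤ κ ^ 2 * R ^ 2 := by
    have e1 := h.norm_br_sub_le hL.le hp.mem hs
    have e2 : ‖P.br xs - P.br s‖ ≤ κ * ‖xs - s‖ := by
      rw [hκ, div_mul_eq_mul_div, le_div_iff₀ hμ, mul_comm]; exact e1
    calc _ ≤ (κ * ‖xs - s‖) ^ 2 := by gcongr
      _ = κ ^ 2 * ‖xs - s‖ ^ 2 := mul_pow _ _ _
      _ ≤ _ := by gcongr
  have hby : ‖P.br s - y‖ ^ 2 ≤ κ * R ^ 2 := by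
    have e1 := h.add_sq_le_maxFun hs hy
    rw [norm_sub_rev, hκ, div_mul_eq_mul_div, le_div_iff₀ hμ]
    linarith
  have hy0 := norm_sub_sq_le_two_mul (P.br xs) (P.br s) y
  -- The three contributions are R², 2κ²R² from the Lipschitz best response and 2κR² from the ascent
  -- phase; κ ≥ 1.
  have htot : ‖xs - s‖ ^ 2 + ‖P.br xs - y‖ ^ 2 ≤ 5 * (κ ^ 2 * R ^ 2) := by
    have e1 : κ * R ^ 2 ≤ κ ^ 2 * R ^ 2 :=
      mul_le_mul_of_nonneg_right (by nlinarith) (sq_nonneg R)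
    have e2 : R ^ 2 ≤ κ ^ 2 * R ^ 2 := le_mul_of_one_le_left (sq_nonneg R) (by nlinarith)
    linarith
  have hdn : ‖xs - (warmOut P s y M n).1‖ ^ 2 + ‖P.br xs - (warmOut P s y M n).2‖ ^ 2
      ≤ 5 * R ^ 2 := by
    refine (hdist n).trans ?_
    calc _ ≤ (1 / 40 : ℝ) ^ n * (5 * (κ ^ 2 * R ^ 2)) := by gcongr
      _ = 5 * ((1 / 40 : ℝ) ^ n * κ ^ 2 * R ^ 2) := by ring
      _ ≤ 5 * (1 * R ^ 2) := by gcongr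
      _ = _ := by ring
  have hlast := h.divergence_extragrad_le hμ hμL hp (h.warmOut_mem hs hy hM0 n) hM rfl
  have heq : extragrad P.X P.Y (regOp P s) (P.L + P.μ) (warmOut P s y M n) M
      = warmOut P s y M (n + 1) := by
    rw [warmOut, warmOut, Function.iterate_succ_apply']
  rw [heq, divergence_add_sq] at hlast
  have hdz := divergence_add_sq P f s xs z
  have hdz0 := h.divergence_nonneg hμ hp hz
  have hz1 : 0 ≤ P.μ / 2 * ‖z - xs‖ ^ 2 := by positivity
  have hz2 : P.μ / 2 * ‖z - s‖ ^ 2 ≤ P.μ / 2 * R ^ 2 := by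
    have := h.diam_X _ hz _ hs
    gcongr
  have hz3 : 0 ≤ P.μ / 2 * ‖(warmOut P s y M (n + 1)).1 - s‖ ^ 2 := by positivity
  have hz4 := mul_le_mul_of_nonneg_left hdn hμ.le
  have hz5 : 0 ≤ P.μ * R ^ 2 := by positivity
  linarith

end IsMaxStructured

/-! ### Expectations of programs -/

namespace Alg

variable {α β : Type}

/-- The program that returns `a` at cost `c`. -/
def det (a : α) (c : Cost) : Alg α := PMF.pure (a, c)

/-- The program `m` with its cost increased by `c`. -/
def charge (c : Cost) (m : Alg α) : Alg α := PMF.map (fun q => (q.1, c + q.2)) m.law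

/-- The program that draws `i` from `p` and then has output and cost `g i`. -/
def sample {ι : Type} (p : PMF ι) (g : ι → α × Cost) : Alg α := PMF.map g p

theorem pure_eq_det (a : α) : (pure a : Alg α) = det a (0, 0) := rfl

theorem gradQuery_eq_det (a : α) : gradQuery a = det a (1, 0) := rfl

theorem brQuery_eq_det (a : α) : brQuery a = det a (0, 1) := rfl

theorem det_bind (a : α) (c : Cost) (k : α → Alg β) : det a c >>= k = charge c (k a) :=
  PMF.pure_bind _ _

theorem charge_det (c c' : Cost) (a : α) : charge c (det a c') = det a (c + c') :=
  PMF.pure_map _ _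

theorem charge_sample {ι : Type} (c : Cost) (p : PMF ι) (g : ι → α × Cost) :
    charge c (sample p g) = sample p fun i => ((g i).1, c + (g i).2) :=
  PMF.map_comp _ _ _

theorem draw_bind_det {ι : Type} (p : PMF ι) (g : ι → α) (c : ι → Cost) :
    (draw p >>= fun i => det (g i) (c i)) = sample p fun i => (g i, c i) := by
  change PMF.bind (PMF.map _ p) _ = _
  rw [PMF.bind_map]
  change _ = PMF.bind p (PMF.pure ∘ fun i => (g i, c i))
  congr 1
  funext i
  exact (PMF.pure_map _ _).trans
    (congrArg (fun c' => PMF.pure (g i, c')) (zero_add (c i)))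

theorem sample_bind_det {ι : Type} (p : PMF ι) (g : ι → α × Cost) (k : α → β) :
    (sample p g >>= fun a => det (k a) (0, 0)) = sample p fun i => (k (g i).1, (g i).2) := by
  change PMF.bind (PMF.map g p) _ = _
  rw [PMF.bind_map]
  change _ = PMF.bind p (PMF.pure ∘ fun i => (k (g i).1, (g i).2))
  congr 1
  funext i
  exact PMF.pure_map _ _

theorem expect_sample {ι : Type} (p : PMF ι) (g : ι → α × Cost) (h : α × Cost → ℝ≥0∞) :
    expect (sample p g) h = ∑' i, p i * h (g i) := by
  simp only [expect, law, sample, PMF.map, PMF.bind_apply, ← ENNReal.tsum_mul_right]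
  rw [ENNReal.tsum_comm]
  refine tsum_congr fun i => ?_
  simp only [mul_assoc]
  rw [ENNReal.tsum_mul_left, tsum_eq_single (g i)]
  · simp [PMF.pure_apply]
  · intro r hr
    simp [PMF.pure_apply, hr]

theorem expect_det (a : α) (c : Cost) (h : α × Cost → ℝ≥0∞) : expect (det a c) h = h (a, c) := by
  rw [expect, tsum_eq_single (a, c)]
  · simp [law, det, PMF.pure_apply]
  · intro r hr
    simp [law, det, PMF.pure_apply, hr]

theorem expect_bind (m : Alg α) (k : α → Alg β) (h : β × Cost → ℝ≥0∞) :
    expect (m >>= k) h = expect m fun r => expect (k r.1) fun q => h (q.1, r.2 + q.2) := by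
  have h1 : ∀ r : α × Cost, expect (k r.1) (fun q => h (q.1, r.2 + q.2))
      = ∑' q, (PMF.map (fun q : β × Cost => (q.1, r.2 + q.2)) (law (k r.1))) q * h q := fun r =>
    (expect_sample (law (k r.1)) _ _).symm
  simp only [h1]
  change ∑' q, (PMF.bind (law m) fun r => PMF.map _ (law (k r.1))) q * h q
    = ∑' r, law m r * _
  simp only [PMF.bind_apply, ← ENNReal.tsum_mul_right, ← ENNReal.tsum_mul_left]
  rw [ENNReal.tsum_comm]
  simp only [mul_assoc]

theorem mem_support_bind {m : Alg α} {k : α → Alg β} {q : β × Cost}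
    (hq : q ∈ (law (m >>= k)).support) :
    ∃ r ∈ (law m).support, ∃ q' ∈ (law (k r.1)).support, q'.1 = q.1 := by
  change q ∈ (PMF.bind (law m) _).support at hq
  rw [PMF.mem_support_bind_iff] at hq
  obtain ⟨r, hr, hq⟩ := hq
  rw [PMF.mem_support_map_iff] at hq
  obtain ⟨q', hq', rfl⟩ := hq
  exact ⟨r, hr, q', hq', rfl⟩

theorem expect_mono (m : Alg α) {h h' : α × Cost → ℝ≥0∞}
    (hh : ∀ r ∈ m.law.support, h r ≤ h' r) : expect m h ≤ expect m h' := by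
  refine ENNReal.tsum_le_tsum fun r => ?_
  by_cases hr : r ∈ m.law.support
  · gcongr; exact hh r hr
  · rw [PMF.mem_support_iff, not_not] at hr
    simp [hr]

theorem expect_add_le (m : Alg α) (h : α × Cost → ℝ≥0∞) (c : ℝ≥0∞) :
    expect m (fun r => h r + c) = expect m h + c := by
  simp only [expect, mul_add]
  rw [ENNReal.tsum_add, ENNReal.tsum_mul_right, PMF.tsum_coe, one_mul]

theorem expect_const_mul (m : Alg α) (h : α × Cost → ℝ≥0∞) (c : ℝ≥0∞) :
    expect m (fun r => c * h r) = c * expect m h := by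
  simp only [expect]
  rw [← ENNReal.tsum_mul_left]
  exact tsum_congr fun r => by ring

/-- An additive functional of the cost is subadditive under composition. -/
theorem expect_cost_bind_le (φ : Cost → ℝ≥0∞) (hφ : ∀ c c', φ (c + c') = φ c + φ c')
    (m : Alg α) (k : α → Alg β) {B : ℝ≥0∞} (hB : ∀ a, expect (k a) (fun q => φ q.2) ≤ B) :
    expect (m >>= k) (fun q => φ q.2) ≤ expect m (fun r => φ r.2) + B := by
  rw [expect_bind, ← expect_add_le]
  refine expect_mono _ fun r _ => ?_
  have h1 : (fun q : β × Cost => φ (r.2 + q.2)) = fun q => φ q.2 + φ r.2 := by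
    funext q; rw [hφ, add_comm]
  rw [h1, expect_add_le, add_comm]
  gcongr
  exact hB _

theorem expect_cost_loop_le (φ : Cost → ℝ≥0∞) (hφ : ∀ c c', φ (c + c') = φ c + φ c')
    (hφ0 : φ (0, 0) = 0) (step : ℕ → α → Alg α) {B : ℝ≥0∞}
    (hB : ∀ t a, expect (step t a) (fun q => φ q.2) ≤ B) (n : ℕ) (a : α) :
    expect (loop step n a) (fun q => φ q.2) ≤ n * B := by
  induction n with
  | zero =>
    rw [loop, pure_eq_det, expect_det, hφ0]
    exact zero_le
  | succ n ih =>
    rw [loop]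
    refine (expect_cost_bind_le φ hφ _ _ (hB n)).trans ?_
    push_cast
    rw [add_mul, one_mul]
    gcongr

/-- A loop keeps an invariant of its state, and a potential which no step increases in
expectation. -/
theorem loop_invariant {step : ℕ → α → Alg α} {I : α → Prop}
    (hI : ∀ t a, I a → ∀ r ∈ (step t a).law.support, I r.1) (n : ℕ) {a : α} (ha : I a) :
    ∀ r ∈ (loop step n a).law.support, I r.1 := by
  induction n with
  | zero =>
    intro r hr
    change r ∈ (PMF.pure (a, ((0, 0) : Cost))).support at hr
    rw [PMF.mem_support_pure_iff] at hr
    rw [hr]; exact ha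
  | succ n ih =>
    intro q hq
    obtain ⟨r, hr, q', hq', he⟩ := mem_support_bind hq
    rw [← he]
    exact hI n r.1 (ih r hr) q' hq'

/-- The invariant holds almost surely, so the one-step bound applies under the expectation. The uses
are c = 1 with the time-dependent RECAPP potential, and c = 1/e for restarts. -/
theorem expect_loop_le {step : ℕ → α → Alg α} {I : α → Prop}
    (hI : ∀ t a, I a → ∀ r ∈ (step t a).law.support, I r.1) {V : ℕ → α → ℝ≥0∞} {c : ℝ≥0∞}
    (hV : ∀ t a, I a → expect (step t a) (fun q => V (t + 1) q.1) ≤ c * V t a)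
    (n : ℕ) {a : α} (ha : I a) :
    expect (loop step n a) (fun q => V n q.1) ≤ c ^ n * V 0 a := by
  induction n with
  | zero =>
    rw [loop, pure_eq_det, expect_det, pow_zero, one_mul]
  | succ n ih =>
    rw [loop, expect_bind]
    calc _ ≤ expect (loop step n a) (fun r => c * V n r.1) :=
          expect_mono _ fun r hr => hV n r.1 (loop_invariant hI n ha r hr)
      _ = c * expect (loop step n a) (fun r => V n r.1) := expect_const_mul _ _ _
      _ ≤ c * (c ^ n * V 0 a) := by gcongr
      _ = _ := by rw [pow_succ', mul_assoc]

theorem loop_det {step : ℕ → α → Alg α} {g : α → α} {c : Cost}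
    (h : ∀ t a, step t a = det (g a) c) (n : ℕ) (a : α) :
    loop step n a = det (g^[n] a) (n • c) := by
  induction n with
  | zero => rw [loop, pure_eq_det, zero_smul]; rfl
  | succ n ih =>
    rw [loop, ih, det_bind, h, charge_det, Function.iterate_succ_apply', succ_nsmul]

end Alg

open Alg

/-! ### The laws of the programs -/

theorem regGrad_eq (P : Access E E') (s x : E) (y : E') :
    regGrad P s x y = det (regOp P s x y) (1, 0) := by
  rw [regGrad, gradQuery_eq_det, det_bind, pure_eq_det, charge_det]
  rfl

theorem mirrorProxStep_eq (P : Access E E') (s : E) (η : ℝ) (S : (E × E') × (E × E')) :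
    mirrorProxStep P.X P.Y (regGrad P s) η S
      = det (extragradStep P.X P.Y (regOp P s) η S) (2, 0) := by
  simp only [mirrorProxStep, regGrad_eq, det_bind, pure_eq_det, charge_det]
  rfl

theorem mirrorProx_eq (P : Access E E') (s : E) (ℓ : ℝ) (z₀ : E × E') (T : ℕ) :
    mirrorProx P.X P.Y (regGrad P s) ℓ z₀ T
      = det (extragrad P.X P.Y (regOp P s) ℓ z₀ T) (T • (2, 0)) := by
  rw [mirrorProx, loop_det (fun _ S => mirrorProxStep_eq P s (1 / ℓ) S), det_bind, pure_eq_det,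
    charge_det]
  simp only [extragrad]
  congr 1

/-- The output of ApproxProx as a deterministic map. -/
def proxOut (P : Access E E') (M : ℕ) (s xinit xprev : E) : E :=
  (extragrad P.X P.Y (regOp P s) (P.L + P.μ) (xinit, P.br xprev) M).1

theorem approxProx_eq (P : Access E E') (M : ℕ) (s xinit xprev : E) :
    approxProx P M s xinit xprev = det (proxOut P M s xinit xprev) (2 * M, 1) := by
  simp only [approxProx, brQuery_eq_det, det_bind, mirrorProx_eq, charge_det, pure_eq_det]
  rw [proxOut]
  congr 1
  simp [mul_comm]

/-- The `j`-th iterate of UnbiasedProx. -/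
def proxSeq (P : Access E E') (M : ℕ) (s xprev : E) (j : ℕ) : E :=
  (fun x => proxOut P M s x x)^[j] (proxOut P M s s xprev)

/-- The output of UnbiasedProx with offset `2` when the geometric variable has the value `k`. -/
def unbiasedOut (P : Access E E') (M : ℕ) (s xprev : E) (k : ℕ) : E :=
  proxSeq P M s xprev 2
    + (2 : ℝ) ^ (k + 1) • (proxSeq P M s xprev (k + 2) - proxSeq P M s xprev (max (k + 1) 2))

/-- The recorded history is tracked as a whole function: entries beyond J still hold the initial
constant and are never read. -/
theorem unbiasedProx_loop_eq (P : Access E E') (M : ℕ) (s xprev : E) (J : ℕ) :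
    loop (fun j (h : ℕ → E) => do
      let x ← approxProx P M s (h j) (h j)
      pure (Function.update h (j + 1) x)) J (fun _ => proxOut P M s s xprev)
    = det (fun j => if j ≤ J then proxSeq P M s xprev j else proxOut P M s s xprev)
        (J • (2 * M, 1)) := by
  induction J with
  | zero =>
    rw [loop, pure_eq_det, zero_smul]
    congr 1
    funext j
    split_ifs with hj
    · rw [Nat.le_zero.1 hj]; rfl
    · rfl
  | succ J ih =>
    rw [loop, ih, det_bind]
    simp only [approxProx_eq, det_bind, pure_eq_det, charge_det, le_refl, if_true]
    rw [succ_nsmul]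
    congr 1
    funext j
    rcases lt_trichotomy j (J + 1) with hj | rfl | hj
    · rw [Function.update_of_ne hj.ne, if_pos (Nat.lt_succ_iff.1 hj), if_pos hj.le]
    · rw [Function.update_self, if_pos le_rfl, proxSeq, proxSeq, Function.iterate_succ_apply']
    · rw [Function.update_of_ne hj.ne', if_neg (by omega), if_neg (by omega)]

/-- Only the level k is random. The count 3 + k is one initial call plus J = 2 + k in the loop. -/
theorem unbiasedProx_eq (P : Access E E') (M : ℕ) (s xprev : E) :
    unbiasedProx P M 2 s xprev
      = sample geomHalf fun k => (unbiasedOut P M s xprev k, (3 + k) • (2 * M, 1)) := by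
  rw [unbiasedProx]
  simp only [approxProx_eq, det_bind]
  have h1 : ∀ k : ℕ, (do
      let h ← loop (fun j (h : ℕ → E) => charge (2 * M, 1)
        (pure (Function.update h (j + 1) (proxOut P M s (h j) (h j))))) (2 + k)
        (fun _ => proxOut P M s s xprev)
      pure (h 2 + (((1 : ℝ) - 1 / 2) * (1 / 2) ^ k)⁻¹ • (h (2 + k) - h (max (2 + k - 1) 2))))
      = det (unbiasedOut P M s xprev k) ((2 + k) • (2 * M, 1)) := fun k => by
    have h2 := unbiasedProx_loop_eq P M s xprev (2 + k)
    simp only [approxProx_eq, det_bind] at h2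
    rw [h2, det_bind, pure_eq_det, charge_det]
    have h3 : (((1 : ℝ) - 1 / 2) * (1 / 2) ^ k)⁻¹ = 2 ^ (k + 1) := by
      rw [one_div, mul_inv, ← inv_pow, inv_inv, pow_succ']; norm_num
    beta_reduce
    rw [if_pos (by omega), if_pos (by omega), if_pos (by omega), h3, unbiasedOut, add_comm k 2,
      show 2 + k - 1 = k + 1 by omega]
    congr 1
  simp only [h1]
  rw [draw_bind_det, charge_sample]
  congr 1
  funext k
  rw [show 3 + k = 1 + (2 + k) by omega, add_smul 1, one_smul]

/-- The new second component of the state of RECAPP when the geometric variable is `k`. -/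
def dualOut (P : Access E E') (M : ℕ) (a : ℝ) (S : E × E) (s : E) (k : ℕ) : E :=
  proj P.X (S.2 - a⁻¹ • (s - unbiasedOut P M s S.1 k))

/-- Given the state, the primal update is deterministic and only the dual one depends on k; its own
ApproxProx call raises the count to 4 + k. -/
theorem recappStep_eq (P : Access E E') (M t : ℕ) (S : E × E) {s : E}
    (hs : s = (1 - alpha (t + 1)) • S.1 + alpha (t + 1) • S.2) :
    recappStep P M 2 t S
      = sample geomHalf fun k => ((proxOut P M s s S.1, dualOut P M (alpha (t + 1)) S s k),
          (4 + k) • (2 * M, 1)) := by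
  simp only [recappStep, ← hs, approxProx_eq, det_bind, unbiasedProx_eq, pure_eq_det]
  rw [sample_bind_det, charge_sample]
  congr 1
  funext k
  rw [show 4 + k = 1 + (3 + k) by omega, add_smul 1, one_smul]
  rfl

theorem agd_eq (P : Access E E') (x : E) (y₀ : E') (N : ℕ) :
    agd P x y₀ N = det (agdOut P x y₀ N) (1 + N, 0) := by
  have h1 : ∀ (_ : ℕ) S, agdStep P x S = det (agdMap P x S) (1, 0) := fun _ S => by
    simp only [agdStep, gradQuery_eq_det, det_bind, pure_eq_det, charge_det]
    rfl
  simp only [agd, gradQuery_eq_det, det_bind, loop_det h1, pure_eq_det, charge_det]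
  rw [agdOut]
  congr 1
  simp

theorem warmStart_eq (P : Access E E') (w : WarmParams) (xinit : E) (yinit : E') :
    warmStart P w xinit yinit
      = det (warmOut P xinit (agdOut P xinit yinit w.N) w.T w.K).1
          (1 + w.N + 2 * w.T * w.K, 0) := by
  have h1 : ∀ (_ : ℕ) z, mirrorProx P.X P.Y (regGrad P xinit) (P.L + P.μ) z w.T
      = det (extragrad P.X P.Y (regOp P xinit) (P.L + P.μ) z w.T) (w.T • (2, 0)) :=
    fun _ z => mirrorProx_eq P xinit _ z w.T
  simp only [warmStart, agd_eq, det_bind, loop_det h1, pure_eq_det, charge_det]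
  rw [warmOut]
  congr 1
  simp only [Prod.ext_iff, Prod.fst_add, Prod.snd_add, Prod.smul_fst, Prod.smul_snd, smul_eq_mul]
  constructor
  · ring
  · simp

/-! ### The sequence α and sums against the geometric law. -/

theorem alpha_succ_le (t : ℕ) : alpha (t + 1) ≤ 2 / 3 := by
  have h0 := alpha_pos t
  have h1 : 4 ≤ 4 / alpha t ^ 2 := by
    rw [le_div_iff₀ (by positivity)]
    nlinarith [alpha_le_one t]
  have h2 : 2 ≤ Real.sqrt (1 + 4 / alpha t ^ 2) := Real.le_sqrt_of_sq_le (by linarith)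
  rw [alpha, div_le_div_iff₀ (by positivity) (by norm_num)]
  linarith

theorem alpha_le (t : ℕ) : alpha t ≤ 2 / (t + 2) := by
  induction t with
  | zero => simp [alpha]
  | succ t ih =>
    have h0 := alpha_pos t
    have h1 : 2 / alpha t ≤ Real.sqrt (1 + 4 / alpha t ^ 2) := by
      refine Real.le_sqrt_of_sq_le ?_
      rw [div_pow]; norm_num
    have h2 : (t : ℝ) + 2 ≤ 2 / alpha t := by
      rw [le_div_iff₀ h0]
      rwa [le_div_iff₀ (by positivity), mul_comm] at ih
    rw [alpha]
    push_cast
    exact div_le_div_of_nonneg_left (by norm_num) (by positivity) (by linarith)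

theorem geomHalf_apply (k : ℕ) : geomHalf k = ENNReal.ofReal ((1 / 2) ^ (k + 1)) := by
  change (2⁻¹ : ℝ≥0∞) ^ (k + 1) = _
  rw [ENNReal.ofReal_pow (by norm_num), one_div, ENNReal.ofReal_inv_of_pos (by norm_num)]
  norm_num

/-- Lets a majorant with signed mean-zero terms be summed in ℝ, where they cancel. Each Q k is
nonnegative as a whole, so the sum agrees with the extended one. -/
theorem tsum_geomHalf_mul_ofReal_le {q Q : ℕ → ℝ} (h0 : ∀ k, 0 ≤ q k) (hq : ∀ k, q k ≤ Q k)
    {S : ℝ} (hS : HasSum (fun k => (1 / 2 : ℝ) ^ (k + 1) * Q k) S) :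
    ∑' k, geomHalf k * ENNReal.ofReal (q k) ≤ ENNReal.ofReal S := by
  rw [← hS.tsum_eq, ENNReal.ofReal_tsum_of_nonneg
    (fun k => mul_nonneg (by positivity) ((h0 k).trans (hq k))) hS.summable]
  refine ENNReal.tsum_le_tsum fun k => ?_
  rw [geomHalf_apply, ← ENNReal.ofReal_mul (by positivity)]
  exact ENNReal.ofReal_le_ofReal (mul_le_mul_of_nonneg_left (hq k) (by positivity))

theorem hasSum_of_eq {g h : ℕ → ℝ} {a b : ℝ} (hs : HasSum g a) (hg : ∀ k, h k = g k)
    (hb : b = a) : HasSum h b := by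
  rw [hb, funext hg]
  exact hs

theorem hasSum_half_pow : HasSum (fun k : ℕ => (1 / 2 : ℝ) ^ (k + 1)) 1 := by
  exact hasSum_of_eq (hasSum_geometric_two.mul_left (1 / 2 : ℝ)) (fun k => pow_succ' _ _)
    (by norm_num)

theorem hasSum_half_pow_mul_four_add (c : ℝ) :
    HasSum (fun k : ℕ => (1 / 2 : ℝ) ^ (k + 1) * ((4 + k) * c)) (5 * c) := by
  have h1 := (hasSum_coe_mul_geometric_of_norm_lt_one (r := (1 / 2 : ℝ)) (by norm_num)).mul_left
    (c / 2)
  have h2 := hasSum_half_pow.mul_left (4 * c)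
  exact hasSum_of_eq (h2.add h1) (fun k => by ring) (by norm_num; ring)

theorem hasSum_half_pow_mul_quarter_pow :
    HasSum (fun k : ℕ => (1 / 2 : ℝ) ^ (k + 1) * (1 / 4) ^ k) (4 / 7) := by
  have h := (hasSum_geometric_of_lt_one (r := (1 / 8 : ℝ)) (by norm_num) (by norm_num)).mul_left
    (1 / 2)
  refine hasSum_of_eq h (fun k => ?_) (by norm_num)
  rw [pow_succ', mul_assoc, ← mul_pow]
  norm_num

/-! ### Expected costs -/

/-- The map φ stands for either cost coordinate. The mean of 4 + k is 5. -/
theorem expect_recappStep_le (P : Access E E') (M t : ℕ) (S : E × E) (φ : Cost → ℕ)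
    (hφ : ∀ (n : ℕ) (c : Cost), φ (n • c) = n * φ c) :
    expect (recappStep P M 2 t S) (fun q => (φ q.2 : ℝ≥0∞))
      ≤ ENNReal.ofReal (5 * φ (2 * M, 1)) := by
  rw [recappStep_eq P M t S rfl, expect_sample]
  have h1 : ∀ k : ℕ, ((φ ((4 + k) • (2 * M, 1)) : ℕ) : ℝ≥0∞)
      = ENNReal.ofReal ((4 + k) * φ (2 * M, 1)) := fun k => by
    rw [hφ, ← ENNReal.ofReal_natCast]
    push_cast
    rfl
  simp only [h1]
  exact tsum_geomHalf_mul_ofReal_le (fun k => by positivity) (fun k => le_rfl)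
    (hasSum_half_pow_mul_four_add _)

theorem expect_recappFrom_cost_le (P : Access E E') (M T : ℕ) (x₀ : E) (φ : Cost → ℕ)
    (hφ : ∀ (n : ℕ) (c : Cost), φ (n • c) = n * φ c) (hadd : ∀ c c', φ (c + c') = φ c + φ c') :
    expect (recappFrom P M 2 T x₀) (fun q => (φ q.2 : ℝ≥0∞))
      ≤ ENNReal.ofReal (5 * φ (2 * M, 1) * T) := by
  have hadd' : ∀ c c', (φ (c + c') : ℝ≥0∞) = φ c + φ c' := fun c c' => by
    rw [hadd]; push_cast; rfl
  have h0 : (φ (0, 0) : ℝ≥0∞) = 0 := by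
    have := hφ 0 (0, 0)
    rw [zero_smul, zero_mul] at this
    exact_mod_cast this
  rw [recappFrom]
  refine (expect_cost_bind_le (fun c => (φ c : ℝ≥0∞)) hadd' _ _ (B := 0) fun S => ?_).trans ?_
  · rw [pure_eq_det, expect_det, h0]
  · rw [add_zero]
    refine (expect_cost_loop_le (fun c => (φ c : ℝ≥0∞)) hadd' h0 _
      (fun t S => expect_recappStep_le P M t S φ hφ) T (x₀, x₀)).trans_eq ?_
    rw [mul_comm (5 * (φ (2 * M, 1) : ℝ)), ENNReal.ofReal_mul (p := (T : ℝ)) (by positivity),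
      ENNReal.ofReal_natCast]

/-- The potential of the state `(x, v)` of RECAPP after `t` iterations, for the comparator `z`. -/
def potential (P : Access E E') (f : E → E' → ℝ) (z : E) (t : ℕ) (S : E × E) : ℝ :=
  1 / alpha t ^ 2 * (maxFun f P.Y S.1 - maxFun f P.Y z) + P.μ / 2 * ‖S.2 - z‖ ^ 2

namespace IsMaxStructured

variable {P : Access E E'} {f : E → E' → ℝ} {R R' : ℝ}
  [FiniteDimensional ℝ E] [FiniteDimensional ℝ E']

theorem proxOut_mem (h : IsMaxStructured P f R R') {M : ℕ} (hM : 0 < M) (s xinit xprev : E) :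
    proxOut P M s xinit xprev ∈ P.X :=
  (h.extragrad_mem _ _ _ hM).1

theorem proxSeq_mem (h : IsMaxStructured P f R R') {M : ℕ} (hM : 0 < M) (s xprev : E) (j : ℕ) :
    proxSeq P M s xprev j ∈ P.X := by
  cases j with
  | zero => exact h.proxOut_mem hM _ _ _
  | succ j =>
    rw [proxSeq, Function.iterate_succ_apply']
    exact h.proxOut_mem hM _ _ _

omit [FiniteDimensional ℝ E'] in
theorem dualOut_mem (h : IsMaxStructured P f R R') (M : ℕ) (a : ℝ) (S : E × E) (s : E) (k : ℕ) :
    dualOut P M a S s k ∈ P.X :=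
  proj_mem h.isCompact_X h.nonempty_X _

theorem recappStep_support (h : IsMaxStructured P f R R') {M : ℕ} (hM : 0 < M) (t : ℕ)
    (S : E × E) : ∀ r ∈ (recappStep P M 2 t S).law.support, r.1 ∈ P.X ×ˢ P.X := by
  intro r hr
  rw [recappStep_eq P M t S rfl] at hr
  obtain ⟨k, -, rfl⟩ := (PMF.mem_support_map_iff _ _ _).1 hr
  exact ⟨h.proxOut_mem hM _ _ _, h.dualOut_mem _ _ _ _ _⟩

theorem recappFrom_support (h : IsMaxStructured P f R R') {M : ℕ} (hM : 0 < M) (T : ℕ) {x₀ : E}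
    (hx : x₀ ∈ P.X) : ∀ r ∈ (recappFrom P M 2 T x₀).law.support, r.1 ∈ P.X := by
  intro q hq
  obtain ⟨r, hr, q', hq', he⟩ := mem_support_bind hq
  have h1 := loop_invariant (I := fun S => S ∈ P.X ×ˢ P.X)
    (fun t a _ => h.recappStep_support hM t a) T (a := (x₀, x₀)) ⟨hx, hx⟩ r hr
  rw [pure_eq_det] at hq'
  have h2 : q' = (r.1.1, (0, 0)) := (PMF.mem_support_pure_iff _ _).1 hq'
  rw [← he, h2]
  exact h1.1

/-! ### ApproxProx and UnbiasedProx -/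

theorem divergence_proxOut_le (h : IsMaxStructured P f R R') (hμ : 0 < P.μ) (hμL : P.μ ≤ P.L)
    {s xs : E} (hp : IsProxPoint P s xs) {xinit xprev : E} (hi : xinit ∈ P.X) (hx : xprev ∈ P.X)
    {M : ℕ} (hM : 80 * P.L ≤ P.μ * M) :
    divergence P f s xs (proxOut P M s xinit xprev)
        + P.μ / 2 * ‖proxOut P M s xinit xprev - xs‖ ^ 2
      ≤ 1 / 16 * (divergence P f s xs xprev + P.μ / 2 * ‖xinit - xs‖ ^ 2) := by
  have h1 := h.divergence_extragrad_le hμ hμL hp (z₀ := (xinit, P.br xprev))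
    ⟨hi, h.br_mem _ hx⟩ hM rfl
  have h2 := h.br_sq_le_divergence hp hx
  rw [norm_sub_rev xs, norm_sub_rev (P.br xs)] at h1
  rw [proxOut]
  linarith

theorem divergence_proxSeq_le (h : IsMaxStructured P f R R') (hμ : 0 < P.μ) (hμL : P.μ ≤ P.L)
    {s xs : E} (hs : s ∈ P.X) (hp : IsProxPoint P s xs) {xprev : E} (hx : xprev ∈ P.X)
    {M : ℕ} (hM : 80 * P.L ≤ P.μ * M) (hM0 : 0 < M) (j : ℕ) :
    divergence P f s xs (proxSeq P M s xprev j) + P.μ / 2 * ‖proxSeq P M s xprev j - xs‖ ^ 2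
      ≤ (1 / 16) ^ (j + 1) * (divergence P f s xs xprev + P.μ / 2 * ‖s - xs‖ ^ 2) := by
  induction j with
  | zero => simpa [proxSeq] using h.divergence_proxOut_le hμ hμL hp hs hx hM
  | succ j ih =>
    have hj := h.proxSeq_mem hM0 s xprev j
    have h1 := h.divergence_proxOut_le hμ hμL hp hj hj hM
    have h2 : proxSeq P M s xprev (j + 1)
        = proxOut P M s (proxSeq P M s xprev j) (proxSeq P M s xprev j) := by
      rw [proxSeq, Function.iterate_succ_apply']; rfl
    rw [h2, pow_succ' _ (j + 1), mul_assoc]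
    exact h1.trans (mul_le_mul_of_nonneg_left ih (by norm_num))

theorem sq_proxSeq_le (h : IsMaxStructured P f R R') (hμ : 0 < P.μ) (hμL : P.μ ≤ P.L)
    {s xs : E} (hs : s ∈ P.X) (hp : IsProxPoint P s xs) {xprev : E} (hx : xprev ∈ P.X)
    {M : ℕ} (hM : 80 * P.L ≤ P.μ * M) (hM0 : 0 < M) (j : ℕ) :
    P.μ / 2 * ‖proxSeq P M s xprev j - xs‖ ^ 2
      ≤ (1 / 16) ^ (j + 1) * (divergence P f s xs xprev + P.μ / 2 * ‖s - xs‖ ^ 2) := by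
  have h1 := h.divergence_proxSeq_le hμ hμL hs hp hx hM hM0 j
  have h2 := h.divergence_nonneg hμ hp (h.proxSeq_mem hM0 s xprev j)
  linarith

/-- UnbiasedProx is unbiased. -/
theorem hasSum_inner_unbiasedOut (h : IsMaxStructured P f R R') (hμ : 0 < P.μ) (hμL : P.μ ≤ P.L)
    {s xs : E} (hs : s ∈ P.X) (hp : IsProxPoint P s xs) {xprev : E} (hx : xprev ∈ P.X)
    {M : ℕ} (hM : 80 * P.L ≤ P.μ * M) (hM0 : 0 < M) (w : E) :
    HasSum (fun k => (1 / 2 : ℝ) ^ (k + 1) * ⟪w, unbiasedOut P M s xprev k - xs⟫) 0 := by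
  have hA : 0 ≤ divergence P f s xs xprev + P.μ / 2 * ‖s - xs‖ ^ 2 :=
    add_nonneg (h.divergence_nonneg hμ hp hx) (by positivity)
  have hseq := h.sq_proxSeq_le hμ hμL hs hp hx hM hM0
  set A := divergence P f s xs xprev + P.μ / 2 * ‖s - xs‖ ^ 2
  -- The weight 2^(k+1) cancels the probability, so the corrections sum to the telescoping series of
  -- b, whose total -b 0 offsets the base term. The maximum makes b 0 = b 1, matching the vanishing
  -- correction at k = 0.
  set b : ℕ → ℝ := fun k => ⟪w, proxSeq P M s xprev (max (k + 1) 2) - xs⟫ with hb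
  have hsum : Summable b := by
    refine Summable.of_norm_bounded (g := fun k => ‖w‖ * Real.sqrt (2 * A / P.μ) * (1 / 4) ^ k)
      ((summable_geometric_of_lt_one (by norm_num) (by norm_num)).mul_left _) fun k => ?_
    refine (norm_inner_le_norm _ _).trans ?_
    rw [mul_assoc]
    gcongr
    have h1 := hseq (max (k + 1) 2)
    have h2 : (1 / 16 : ℝ) ^ (max (k + 1) 2 + 1) ≤ (1 / 16) ^ k :=
      pow_le_pow_of_le_one (by norm_num) (by norm_num) (by omega)
    have h3 : ((1 / 4 : ℝ) ^ k) ^ 2 = (1 / 16) ^ k := by rw [← pow_mul, mul_comm, pow_mul]; norm_num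
    refine abs_le_of_sq_le_sq' ?_ (by positivity) |>.2
    rw [mul_pow, Real.sq_sqrt (by positivity), h3, div_mul_eq_mul_div, le_div_iff₀ hμ]
    have h4 := mul_le_mul_of_nonneg_right h2 hA
    linarith
  have htel : HasSum (fun k => b (k + 1) - b k) (-b 0) := by
    have h1 := (hasSum_nat_add_iff' 1).2 hsum.hasSum
    exact hasSum_of_eq (h1.sub hsum.hasSum) (fun k => rfl) (by simp)
  refine hasSum_of_eq ((hasSum_half_pow.mul_right (b 0)).add htel) (fun k => ?_) ?_
  · have h1 : max (k + 1 + 1) 2 = k + 2 := by omega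
    have h2 : unbiasedOut P M s xprev k - xs = (proxSeq P M s xprev (max (0 + 1) 2) - xs)
        + (2 : ℝ) ^ (k + 1) • ((proxSeq P M s xprev (max (k + 1 + 1) 2) - xs)
          - (proxSeq P M s xprev (max (k + 1) 2) - xs)) := by
      rw [unbiasedOut, h1, show max (0 + 1) 2 = 2 from rfl, sub_sub_sub_cancel_right]
      abel
    have h3 : ⟪w, unbiasedOut P M s xprev k - xs⟫
        = b 0 + (2 : ℝ) ^ (k + 1) * (b (k + 1) - b k) := by
      rw [h2, inner_add_right, real_inner_smul_right,
        inner_sub_right w (proxSeq P M s xprev (max (k + 1 + 1) 2) - xs)]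
    have h4 : (1 / 2 : ℝ) ^ (k + 1) * 2 ^ (k + 1) = 1 := by rw [← mul_pow]; norm_num
    rw [h3]
    linear_combination (b (k + 1) - b k) * h4
  · ring

/-- A bound for the error of UnbiasedProx, given the value of the geometric variable. -/
theorem sq_unbiasedOut_le (h : IsMaxStructured P f R R') (hμ : 0 < P.μ) (hμL : P.μ ≤ P.L)
    {s xs : E} (hs : s ∈ P.X) (hp : IsProxPoint P s xs) {xprev : E} (hx : xprev ∈ P.X)
    {M : ℕ} (hM : 80 * P.L ≤ P.μ * M) (hM0 : 0 < M) (k : ℕ) :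
    P.μ / 2 * ‖unbiasedOut P M s xprev k - xs‖ ^ 2
      ≤ (1 / 2048 + 1 / 8 * (1 / 4) ^ k)
        * (divergence P f s xs xprev + P.μ / 2 * ‖s - xs‖ ^ 2) := by
  have hA : 0 ≤ divergence P f s xs xprev + P.μ / 2 * ‖s - xs‖ ^ 2 :=
    add_nonneg (h.divergence_nonneg hμ hp hx) (by positivity)
  have hseq := h.sq_proxSeq_le hμ hμL hs hp hx hM hM0
  set A := divergence P f s xs xprev + P.μ / 2 * ‖s - xs‖ ^ 2
  have h1 := hseq 2
  have h2 := hseq (k + 2)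
  have h3 := hseq (max (k + 1) 2)
  set x2 := proxSeq P M s xprev 2
  set x' := proxSeq P M s xprev (k + 2)
  set x'' := proxSeq P M s xprev (max (k + 1) 2)
  -- The older of the two iterates in the correction has the larger bound, 16^(-(k+2)); against the
  -- squared weight 4^(k+1) this leaves a multiple of 4^(-k).
  have h4 : (1 / 16 : ℝ) ^ (max (k + 1) 2 + 1) ≤ (1 / 16) ^ (k + 2) :=
    pow_le_pow_of_le_one (by norm_num) (by norm_num) (by omega)
  have h5 := mul_le_mul_of_nonneg_right h4 hA
  have h6 := norm_sub_sq_le_two_mul x' xs x''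
  rw [norm_sub_rev xs] at h6
  have h7 : ‖unbiasedOut P M s xprev k - xs‖ ^ 2
      ≤ 2 * ‖x2 - xs‖ ^ 2 + 2 * (4 ^ (k + 1) * ‖x' - x''‖ ^ 2) := by
    have e1 : unbiasedOut P M s xprev k - xs = (x2 - xs) - -((2 : ℝ) ^ (k + 1) • (x' - x'')) := by
      rw [unbiasedOut]; abel
    have e2 := norm_sub_sq_le_two_mul (x2 - xs) 0 (-((2 : ℝ) ^ (k + 1) • (x' - x'')))
    rw [sub_zero, zero_sub, neg_neg, norm_smul, mul_pow, Real.norm_eq_abs, sq_abs, ← pow_mul,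
      mul_comm (k + 1), pow_mul] at e2
    norm_num only at e2
    rw [e1]
    exact e2
  have h8 : P.μ / 2 * ‖x' - x''‖ ^ 2 ≤ 4 * ((1 / 16) ^ (k + 2) * A) := by
    have e1 : (1 / 16 : ℝ) ^ (k + 2 + 1) * A ≤ (1 / 16) ^ (k + 2) * A :=
      mul_le_mul_of_nonneg_right
        (pow_le_pow_of_le_one (by norm_num) (by norm_num) (by omega)) hA
    have e2 := mul_le_mul_of_nonneg_left h6 (by positivity : 0 ≤ P.μ / 2)
    linarith
  have h9 : (4 : ℝ) ^ (k + 1) * (1 / 16) ^ (k + 2) = 1 / 64 * (1 / 4) ^ k := by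
    have e1 : (1 / 16 : ℝ) ^ k = (1 / 4) ^ k * (1 / 4) ^ k := by rw [← mul_pow]; norm_num
    have e2 : (4 : ℝ) ^ k * (1 / 4) ^ k = 1 := by rw [← mul_pow]; norm_num
    rw [pow_succ, pow_add, e1]
    linear_combination (1 / 64 * (1 / 4 : ℝ) ^ k) * e2
  have h10 := mul_le_mul_of_nonneg_left h8 (by positivity : (0 : ℝ) ≤ 4 ^ (k + 1))
  have h11 : (4 : ℝ) ^ (k + 1) * (4 * ((1 / 16) ^ (k + 2) * A)) = 1 / 16 * (1 / 4) ^ k * A := by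
    linear_combination (4 * A) * h9
  have h12 := mul_le_mul_of_nonneg_left h7 (by positivity : 0 ≤ P.μ / 2)
  linarith

/-! ### The potential of RECAPP -/

/-- The exact proximal descent has two slacks: (1 - a)D(x), at least D(x)/3 as a ≤ 2/3, and (μ/2)‖x'
- s‖², which controls ‖s - xs‖² because x' is close to xs. They pay for the ApproxProx error and for
1/2048 + 1/14, the mean second-moment constant of UnbiasedProx. -/
theorem recapp_descent (h : IsMaxStructured P f R R') (hμ : 0 < P.μ) (hμL : P.μ ≤ P.L)
    {M : ℕ} (hM : 80 * P.L ≤ P.μ * M) {x v z s xs : E} {a : ℝ} (ha0 : 0 < a) (ha : a ≤ 2 / 3)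
    (hx : x ∈ P.X) (hz : z ∈ P.X) (hs : s ∈ P.X) (hsdef : s = (1 - a) • x + a • v)
    (hp : IsProxPoint P s xs) :
    maxFun f P.Y (proxOut P M s s x) - maxFun f P.Y z - P.μ * (a * ⟪s - xs, v - z⟫)
      + P.μ / 2 * ‖s - xs‖ ^ 2
      + (1 / 2048 + 1 / 14) * (divergence P f s xs x + P.μ / 2 * ‖s - xs‖ ^ 2)
      ≤ (1 - a) * (maxFun f P.Y x - maxFun f P.Y z) := by
  have hM0 : 0 < M := by
    rcases Nat.eq_zero_or_pos M with rfl | h0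
    · simp only [Nat.cast_zero, mul_zero] at hM; linarith
    · exact h0
  have h1 := h.divergence_proxOut_le hμ hμL hp hs hx hM
  have hD' := h.divergence_nonneg hμ hp (h.proxOut_mem hM0 s s x)
  have h2 := divergence_add_sq P f s xs (proxOut P M s s x)
  have h3 := norm_sub_sq_le_two_mul s (proxOut P M s s x) xs
  rw [norm_sub_rev s (proxOut P M s s x)] at h3
  set x' := proxOut P M s s x
  have hDx := h.divergence_nonneg hμ hp hx
  have hDz := h.divergence_nonneg hμ hp hz
  have h4 : (1 - a) * ⟪s - xs, x - xs⟫ + a * ⟪s - xs, z - xs⟫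
      = ‖s - xs‖ ^ 2 - a * ⟪s - xs, v - z⟫ := by
    rw [← real_inner_self_eq_norm_sq, ← real_inner_smul_right, ← real_inner_smul_right,
      ← real_inner_smul_right, ← inner_add_right, ← inner_sub_right]
    congr 1
    nth_rewrite 1 [hsdef]
    module
  have h5 : (1 - a) * divergence P f s xs x + a * divergence P f s xs z
      = (1 - a) * maxFun f P.Y x + a * maxFun f P.Y z - maxFun f P.Y xs
        - P.μ * (‖s - xs‖ ^ 2 - a * ⟪s - xs, v - z⟫) := by
    rw [← h4, divergence, divergence]; ring
  have h6 := mul_nonneg ha0.le hDz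
  -- The surplus D(x)/3 is what a plain convexity argument would discard.
  have h7 : 1 / 3 * divergence P f s xs x ≤ (1 - a) * divergence P f s xs x :=
    mul_le_mul_of_nonneg_right (by linarith) hDx
  have h8 := mul_le_mul_of_nonneg_left h3 hμ.le
  have h9 : 0 ≤ P.μ * ‖s - xs‖ ^ 2 := by positivity
  rw [norm_sub_rev xs s] at h2
  linarith

/-- Optimality of z keeps the potential nonnegative on X, so `ENNReal.ofReal` truncates nothing. -/
theorem expect_potential_le (h : IsMaxStructured P f R R') (hμ : 0 < P.μ) (hμL : P.μ ≤ P.L)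
    {M : ℕ} (hM : 80 * P.L ≤ P.μ * M) {z : E} (hz : z ∈ P.X)
    (hmin : IsMinOn (maxFun f P.Y) P.X z) (t : ℕ) {S : E × E} (hS : S ∈ P.X ×ˢ P.X) :
    expect (recappStep P M 2 t S) (fun q => ENNReal.ofReal (potential P f z (t + 1) q.1))
      ≤ ENNReal.ofReal (potential P f z t S) := by
  have hM0 : 0 < M := by
    rcases Nat.eq_zero_or_pos M with rfl | h0
    · simp only [Nat.cast_zero, mul_zero] at hM; linarith
    · exact h0
  have hL : 0 < P.L := hμ.trans_le hμL
  obtain ⟨x, v⟩ := S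
  obtain ⟨hx, hv⟩ := hS
  simp only at hx hv
  set a := alpha (t + 1) with ha
  have ha0 : 0 < a := alpha_pos _
  have ha1 : a ≤ 2 / 3 := alpha_succ_le t
  obtain ⟨s, hsdef⟩ : ∃ s, s = (1 - a) • x + a • v := ⟨_, rfl⟩
  have hs : s ∈ P.X := by
    rw [hsdef]
    exact h.convex_X hx hv (by linarith) ha0.le (by ring)
  obtain ⟨xs, hp⟩ := h.exists_isProxPoint hμ hL.le s
  rw [recappStep_eq P M t (x, v) hsdef, expect_sample]
  simp only
  have hA : 0 ≤ divergence P f s xs x + P.μ / 2 * ‖s - xs‖ ^ 2 :=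
    add_nonneg (h.divergence_nonneg hμ hp hx) (by positivity)
  have hdesc := h.recapp_descent hμ hμL hM ha0 ha1 hx hz hs hsdef hp
  have hx' := h.proxOut_mem hM0 s s x
  have hvar := h.sq_unbiasedOut_le hμ hμL hs hp hx hM hM0
  set A := divergence P f s xs x + P.μ / 2 * ‖s - xs‖ ^ 2
  set x' := proxOut P M s s x
  -- The displacement from z after an exact dual step without projection; e k is the estimator's
  -- error.
  set w := v - z - a⁻¹ • (s - xs) with hw
  set e : ℕ → E := fun k => unbiasedOut P M s x k - xs with he
  have hmean := h.hasSum_inner_unbiasedOut hμ hμL hs hp hx hM hM0 w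
  -- Expansion of ‖w + a⁻¹ e‖²: the middle term has mean zero, and 1/8 · 4/7 = 1/14 is the mean of
  -- the decaying part.
  set Q : ℕ → ℝ := fun k => (1 / a ^ 2 * (maxFun f P.Y x' - maxFun f P.Y z) + P.μ / 2 * ‖w‖ ^ 2)
    + P.μ * a⁻¹ * ⟪w, e k⟫ + 1 / a ^ 2 * ((1 / 2048 + 1 / 8 * (1 / 4) ^ k) * A) with hQ
  have hpot : ∀ k, potential P f z (t + 1) (x', dualOut P M a (x, v) s k)
      = 1 / a ^ 2 * (maxFun f P.Y x' - maxFun f P.Y z)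
        + P.μ / 2 * ‖dualOut P M a (x, v) s k - z‖ ^ 2 := fun k => rfl
  have hFx' : 0 ≤ maxFun f P.Y x' - maxFun f P.Y z := sub_nonneg.2 (hmin hx')
  refine (tsum_geomHalf_mul_ofReal_le (Q := Q) (fun k => ?_) (fun k => ?_)
    (S := (1 / a ^ 2 * (maxFun f P.Y x' - maxFun f P.Y z) + P.μ / 2 * ‖w‖ ^ 2)
      + 1 / a ^ 2 * ((1 / 2048 + 1 / 14) * A)) ?_).trans (ENNReal.ofReal_le_ofReal ?_)
  · rw [hpot]; positivity
  · have h1 : ‖dualOut P M a (x, v) s k - z‖ ^ 2 ≤ ‖w + a⁻¹ • e k‖ ^ 2 := by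
      refine (norm_proj_sub_sq_le h.isCompact_X h.convex_X _ hz).trans_eq ?_
      congr 2
      simp only [hw, he]
      module
    rw [norm_add_sq_real, real_inner_smul_right, norm_smul, mul_pow, Real.norm_eq_abs, sq_abs,
      inv_pow, ← one_div (a ^ 2)] at h1
    have h2 := mul_le_mul_of_nonneg_left (hvar k) (by positivity : 0 ≤ 1 / a ^ 2)
    have h3 := mul_le_mul_of_nonneg_left h1 (by positivity : 0 ≤ P.μ / 2)
    rw [hpot, hQ]
    simp only [he] at h3 ⊢
    linarith
  · have h1 := hasSum_half_pow.mul_right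
      (1 / a ^ 2 * (maxFun f P.Y x' - maxFun f P.Y z) + P.μ / 2 * ‖w‖ ^ 2 + 1 / a ^ 2 * (A / 2048))
    have h2 := hmean.mul_left (P.μ * a⁻¹)
    have h3 := hasSum_half_pow_mul_quarter_pow.mul_right (1 / a ^ 2 * (A / 8))
    refine hasSum_of_eq ((h1.add h2).add h3) (fun k => ?_) (by ring)
    simp only [hQ, he]
    ring
  · have h1 : ‖w‖ ^ 2 = ‖v - z‖ ^ 2 - 2 * (a⁻¹ * ⟪s - xs, v - z⟫) + a⁻¹ ^ 2 * ‖s - xs‖ ^ 2 := by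
      rw [hw, norm_sub_sq_real, real_inner_smul_right, norm_smul, mul_pow, Real.norm_eq_abs,
        sq_abs, real_inner_comm]
    -- The recursion for α is chosen so that the descent inequality, scaled by a⁻², telescopes.
    have h2 : 1 / alpha t ^ 2 = a⁻¹ ^ 2 * (1 - a) := by
      rw [← alpha_succ t, ← ha]
      field_simp
    have h3 := mul_le_mul_of_nonneg_left hdesc (by positivity : 0 ≤ a⁻¹ ^ 2)
    have h4 : a⁻¹ ^ 2 * (P.μ * (a * ⟪s - xs, v - z⟫)) = P.μ * (a⁻¹ * ⟪s - xs, v - z⟫) := by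
      field_simp
    rw [potential, h1, h2, one_div, ← inv_pow]
    simp only
    linarith

/-- `T` iterations of RECAPP from `x₀`. -/
theorem expect_recappFrom_le (h : IsMaxStructured P f R R') (hμ : 0 < P.μ) (hμL : P.μ ≤ P.L)
    {M : ℕ} (hM : 80 * P.L ≤ P.μ * M) {z : E} (hz : z ∈ P.X)
    (hmin : IsMinOn (maxFun f P.Y) P.X z) (T : ℕ) {x₀ : E} (hx : x₀ ∈ P.X) :
    expect (recappFrom P M 2 T x₀)
        (fun r => ENNReal.ofReal (maxFun f P.Y r.1 - maxFun f P.Y z))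
      ≤ ENNReal.ofReal (4 / (T + 2) ^ 2
        * (maxFun f P.Y x₀ - maxFun f P.Y z + P.μ / 2 * ‖x₀ - z‖ ^ 2)) := by
  have hM0 : 0 < M := by
    rcases Nat.eq_zero_or_pos M with rfl | h0
    · simp only [Nat.cast_zero, mul_zero] at hM; linarith
    · exact h0
  have hI : ∀ t (a : E × E), a ∈ P.X ×ˢ P.X →
      ∀ r ∈ (recappStep P M 2 t a).law.support, r.1 ∈ P.X ×ˢ P.X :=
    fun t a _ => h.recappStep_support hM0 t a
  have hloop := expect_loop_le (V := fun t S => ENNReal.ofReal (potential P f z t S)) (c := 1) hI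
    (fun t a ha => by rw [one_mul]; exact h.expect_potential_le hμ hμL hM hz hmin t ha) T
    (a := (x₀, x₀)) ⟨hx, hx⟩
  rw [one_pow, one_mul] at hloop
  have h0 : potential P f z 0 (x₀, x₀)
      = maxFun f P.Y x₀ - maxFun f P.Y z + P.μ / 2 * ‖x₀ - z‖ ^ 2 := by simp [potential, alpha]
  have hV : 0 ≤ maxFun f P.Y x₀ - maxFun f P.Y z + P.μ / 2 * ‖x₀ - z‖ ^ 2 :=
    add_nonneg (sub_nonneg.2 (hmin hx)) (by positivity)
  rw [h0] at hloop
  rw [recappFrom, expect_bind]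
  simp only [pure_eq_det, expect_det]
  have ha := alpha_pos T
  calc _ ≤ expect (loop (recappStep P M 2) T (x₀, x₀))
        (fun r => ENNReal.ofReal (alpha T ^ 2) * ENNReal.ofReal (potential P f z T r.1)) := by
        refine expect_mono _ fun r _ => ?_
        rw [← ENNReal.ofReal_mul (by positivity)]
        refine ENNReal.ofReal_le_ofReal ?_
        rw [potential, mul_add, ← mul_assoc, mul_one_div_cancel (by positivity), one_mul]
        exact le_add_of_nonneg_right (by positivity)
    _ = ENNReal.ofReal (alpha T ^ 2) * expect (loop (recappStep P M 2) T (x₀, x₀))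
        (fun r => ENNReal.ofReal (potential P f z T r.1)) := expect_const_mul _ _ _
    _ ≤ ENNReal.ofReal (alpha T ^ 2) * ENNReal.ofReal _ := by gcongr
    _ ≤ _ := by
        rw [← ENNReal.ofReal_mul (by positivity)]
        refine ENNReal.ofReal_le_ofReal ?_
        refine mul_le_mul_of_nonneg_right ?_ hV
        calc alpha T ^ 2 ≤ (2 / (T + 2)) ^ 2 := by gcongr; exact alpha_le T
          _ = _ := by rw [div_pow]; norm_num

end IsMaxStructured

/-! ### The main bounds -/

/-- A strongly convex function grows quadratically around its minimizer. -/
theorem sq_le_sub_of_strongConvexOn {S : Set E} {F : E → ℝ} {γ : ℝ} (hF : StrongConvexOn S γ F)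
    {x z : E} (hx : x ∈ S) (hz : z ∈ S) (hmin : IsMinOn F S z) :
    γ / 2 * ‖x - z‖ ^ 2 ≤ F x - F z := by
  rw [← sub_nonneg]
  refine nonneg_of_forall_add_mul_nonneg (b := γ / 2 * ‖x - z‖ ^ 2) fun t ht => ?_
  have ht1 : 0 ≤ 1 - t := by linarith [ht.2]
  have h1 := hF.2 hz hx ht1 ht.1.le (by ring)
  have h2 : F z ≤ F ((1 - t) • z + t • x) := hmin (hF.1 hz hx ht1 ht.1.le (by ring))
  rw [norm_sub_rev z] at h1
  simp only [smul_eq_mul] at h1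
  refine nonneg_of_mul_nonneg_right (a := t) ?_ ht.1
  linarith

/-- The number of MirrorProx iterations of one proximal step. -/
def proxIters (L μ : ℝ) : ℕ := ⌈80 * (L / μ)⌉₊

/-- The parameters of WarmStart. -/
def warmParams (L μ R R' : ℝ) : WarmParams where
  N := ⌈2 * (Real.sqrt (L / μ) * Real.posLog (R' / R))⌉₊
  T := proxIters L μ
  K := ⌈2 * Real.log (L / μ)⌉₊ + 1

/-! ### Sizes of the parameters. -/

section Parameters

variable {L μ R R' : ℝ}

theorem le_mul_proxIters (hμ : 0 < μ) : 80 * L ≤ μ * proxIters L μ := by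
  have h1 : 80 * (L / μ) ≤ proxIters L μ := Nat.le_ceil _
  rw [← mul_div_assoc, div_le_iff₀ hμ] at h1
  linarith

theorem proxIters_pos (hμ : 0 < μ) (hμL : μ ≤ L) : 0 < proxIters L μ :=
  Nat.ceil_pos.2 (by have : 0 < L := hμ.trans_le hμL
                     positivity)

theorem proxIters_le (hμ : 0 < μ) (hμL : μ ≤ L) : (proxIters L μ : ℝ) ≤ 81 * (L / μ) := by
  have hκ : 1 ≤ L / μ := (one_le_div hμ).2 hμL
  have h1 := (Nat.ceil_lt_add_one (by positivity : 0 ≤ 80 * (L / μ))).le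
  rw [proxIters]
  linarith

theorem warmParams_bounded (hμ : 0 < μ) (hμL : μ ≤ L) {C : ℝ} (hC : 81 ≤ C) :
    (warmParams L μ R R').Bounded C L μ R R' := by
  have hκ : 1 ≤ L / μ := (one_le_div hμ).2 hμL
  have hlog : 0 ≤ Real.log (L / μ) := Real.log_nonneg hκ
  have hpos : 0 ≤ Real.sqrt (L / μ) * Real.posLog (R' / R) :=
    mul_nonneg (Real.sqrt_nonneg _) Real.posLog_nonneg
  constructor
  · have h1 := (Nat.ceil_lt_add_one (mul_nonneg zero_le_two hpos)).le
    refine h1.trans ?_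
    nlinarith
  · exact (proxIters_le hμ hμL).trans (by gcongr)
  · have h1 := (Nat.ceil_lt_add_one (mul_nonneg zero_le_two hlog)).le
    simp only [warmParams]
    push_cast
    nlinarith

theorem warmParams_cost_le (hμ : 0 < μ) (hμL : μ ≤ L) :
    1 + ((warmParams L μ R R').N : ℝ) + 2 * (warmParams L μ R R').T * (warmParams L μ R R').K
      ≤ 400 * (L / μ * (1 + Real.log (L / μ))
        + Real.sqrt (L / μ) * Real.posLog (R' / R)) := by
  have hκ : 1 ≤ L / μ := (one_le_div hμ).2 hμL
  have hlog : 0 ≤ Real.log (L / μ) := Real.log_nonneg hκ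
  have hpos : 0 ≤ Real.sqrt (L / μ) * Real.posLog (R' / R) :=
    mul_nonneg (Real.sqrt_nonneg _) Real.posLog_nonneg
  have h1 := (Nat.ceil_lt_add_one (mul_nonneg zero_le_two hpos)).le
  have h2 := (Nat.ceil_lt_add_one (mul_nonneg zero_le_two hlog)).le
  have h3 := proxIters_le hμ hμL
  simp only [warmParams]
  push_cast
  have h4 : (proxIters L μ : ℝ) * ((⌈2 * Real.log (L / μ)⌉₊ : ℝ) + 1)
      ≤ 81 * (L / μ) * (2 * (1 + Real.log (L / μ))) := by
    refine mul_le_mul h3 (by linarith) (by positivity) (by positivity)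
  -- Absorbs the additive constants left by rounding.
  have h5 : 1 ≤ L / μ * (1 + Real.log (L / μ)) := by nlinarith
  linarith

/-- As 1/40 ≤ 1/e, about 2 log(L/μ) epochs cancel the factor (L/μ)² in the initial squared distance.
-/
theorem pow_ceil_mul_sq_le_one (hμ : 0 < μ) (hμL : μ ≤ L) :
    (1 / 40 : ℝ) ^ ⌈2 * Real.log (L / μ)⌉₊ * (L / μ) ^ 2 ≤ 1 := by
  have hκ : 0 < L / μ := by have : 0 < L := hμ.trans_le hμL
                            positivity
  set n := ⌈2 * Real.log (L / μ)⌉₊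
  have h1 : 2 * Real.log (L / μ) ≤ n := Nat.le_ceil _
  have h2 : (1 / 40 : ℝ) ≤ Real.exp (-1) := by
    have : Real.exp 1 ≤ 40 := Real.exp_one_lt_d9.le.trans (by norm_num)
    rw [Real.exp_neg, one_div]
    exact inv_anti₀ (Real.exp_pos 1) this
  have h3 : (L / μ) ^ 2 = Real.exp (2 * Real.log (L / μ)) := by
    rw [two_mul, Real.exp_add, Real.exp_log hκ, sq]
  calc (1 / 40 : ℝ) ^ n * (L / μ) ^ 2 ≤ Real.exp (-1) ^ n * (L / μ) ^ 2 := by gcongr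
    _ = Real.exp (-(n : ℝ) + 2 * Real.log (L / μ)) := by
      rw [← Real.exp_nat_mul, h3, ← Real.exp_add]; ring_nf
    _ ≤ 1 := Real.exp_le_one_iff.2 (by linarith)

end Parameters

/-- The warm start is deterministic and makes no best-response call, so it only shifts the gradient
count by n. -/
theorem solves_det_bind {x₀ : E} {n : ℕ} {k : E → Alg E} {X : Set E}
    {F : E → ℝ} {ε G B G' B' : ℝ} (hmem : ∀ r ∈ (k x₀).law.support, r.1 ∈ X) {xs : E}
    (hxs : xs ∈ X) (hmin : IsMinOn F X xs)
    (hsub : expect (k x₀) (fun r => ENNReal.ofReal (F r.1 - F xs)) ≤ ENNReal.ofReal ε)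
    (hG' : 0 ≤ G') (hgrad : expectedGrad (k x₀) ≤ ENNReal.ofReal G') (hG : n + G' ≤ G)
    (hbr : expectedBr (k x₀) ≤ ENNReal.ofReal B') (hB : B' ≤ B) :
    Solves (det x₀ (n, 0) >>= k) X F ε G B where
  mem q hq := by
    obtain ⟨r, hr, q', hq', he⟩ := mem_support_bind hq
    rw [← he]
    rw [(PMF.mem_support_pure_iff _ _).1 hr] at hq'
    exact hmem q' hq'
  subopt := by
    refine ⟨xs, hxs, hmin, ?_⟩
    rw [expect_bind, expect_det]
    exact hsub
  grad_le := by
    rw [expectedGrad, expect_bind, expect_det]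
    have h1 : (fun q : E × Cost => (((n, 0) + q.2 : Cost).1 : ℝ≥0∞))
        = fun q => (q.2.1 : ℝ≥0∞) + n := by
      funext q
      rw [Prod.fst_add, Nat.cast_add, add_comm]
    simp only [h1]
    rw [expect_add_le]
    refine (add_le_add_left hgrad _).trans ?_
    rw [← ENNReal.ofReal_natCast n, ← ENNReal.ofReal_add hG' (by positivity)]
    exact ENNReal.ofReal_le_ofReal (by linarith)
  br_le := by
    rw [expectedBr, expect_bind, expect_det]
    simp only [Prod.snd_add, zero_add]
    exact hbr.trans (ENNReal.ofReal_le_ofReal hB)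

theorem expectedGrad_recappFrom_le (P : Access E E') (M T : ℕ) (x₀ : E) :
    expectedGrad (recappFrom P M 2 T x₀) ≤ ENNReal.ofReal (10 * M * T) := by
  have h1 := expect_recappFrom_cost_le P M T x₀ (fun c => c.1) (fun n c => by simp)
    (fun c c' => by simp)
  refine h1.trans_eq ?_
  push_cast
  congr 1
  ring

theorem expectedBr_recappFrom_le (P : Access E E') (M T : ℕ) (x₀ : E) :
    expectedBr (recappFrom P M 2 T x₀) ≤ ENNReal.ofReal (5 * T) := by
  have h1 := expect_recappFrom_cost_le P M T x₀ (fun c => c.2) (fun n c => by simp)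
    (fun c c' => by simp)
  refine h1.trans_eq ?_
  push_cast
  congr 1
  ring

namespace IsMaxStructured

variable {P : Access E E'} {f : E → E' → ℝ} {R R' : ℝ}
  [FiniteDimensional ℝ E] [FiniteDimensional ℝ E']

omit [FiniteDimensional ℝ E] in
theorem agd_support_le (h : IsMaxStructured P f R R') (hμ : 0 < P.μ) (hμL : P.μ ≤ P.L)
    (hR : 0 < R) (hR' : 0 < R') {x : E} (hx : x ∈ P.X) {y : E'} (hy : y ∈ P.Y) :
    ∀ r ∈ (agd P x y (warmParams P.L P.μ R R').N).law.support,
      maxFun f P.Y x - f x r.1 ≤ P.L * R ^ 2 / 2 := by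
  intro r hr
  rw [agd_eq] at hr
  rw [(PMF.mem_support_pure_iff _ _).1 hr]
  exact h.agdOut_le hμ hμL hR hR' hx hy (Nat.le_ceil _)

/-- The point returned by WarmStart. -/
theorem exists_warmStart_eq (h : IsMaxStructured P f R R') (hμ : 0 < P.μ) (hμL : P.μ ≤ P.L)
    (hR : 0 < R) (hR' : 0 < R') {x : E} (hx : x ∈ P.X) {y : E'} (hy : y ∈ P.Y)
    {w : WarmParams} (hw : w = warmParams P.L P.μ R R') :
    ∃ x₀ ∈ P.X, warmStart P w x y = det x₀ (1 + w.N + 2 * w.T * w.K, 0) ∧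
      ∀ z ∈ P.X, maxFun f P.Y x₀ - maxFun f P.Y z ≤ 3 / 4 * (P.μ * R ^ 2) := by
  subst hw
  have hy' := (h.agdOut_spec hμ hμL hx hy (warmParams P.L P.μ R R').N).1
  have hgap := h.agdOut_le hμ hμL hR hR' hx hy (N := (warmParams P.L P.μ R R').N) (Nat.le_ceil _)
  refine ⟨_, (h.warmOut_mem hx hy' (proxIters_pos hμ hμL) _).1, warmStart_eq P _ x y,
    fun z hz => ?_⟩
  exact h.maxFun_warmOut_le hμ hμL hx hy' hgap (le_mul_proxIters hμ)
    (pow_ceil_mul_sq_le_one hμ hμL) hz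

/-- RECAPP with warm start. -/
theorem solves_recapp (h : IsMaxStructured P f R R') (hμ : 0 < P.μ) (hμL : P.μ ≤ P.L)
    (hR : 0 < R) (hR' : 0 < R') {ε : ℝ} (hε : 0 < ε) {x : E} (hx : x ∈ P.X) {y : E'}
    (hy : y ∈ P.Y) {T : ℕ} (hT : T = ⌊3 * (R * Real.sqrt (P.μ / ε))⌋₊) {C : ℝ} (hC : 2430 ≤ C) :
    Solves (recapp P (warmParams P.L P.μ R R') (proxIters P.L P.μ) 2 T x y) P.X (maxFun f P.Y) ε
      (C * (P.L * R / Real.sqrt (P.μ * ε) + P.L / P.μ * (1 + Real.log (P.L / P.μ))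
        + Real.sqrt (P.L / P.μ) * Real.posLog (R' / R)))
      (C * (R * Real.sqrt (P.μ / ε))) := by
  have hL : 0 < P.L := hμ.trans_le hμL
  obtain ⟨x₀, hx₀, hw, hgap⟩ := h.exists_warmStart_eq hμ hμL hR hR' hx hy rfl
  obtain ⟨z, hz, hmin⟩ := h.exists_isMinOn_maxFun hμ hL.le
  have hcost := warmParams_cost_le (L := P.L) (μ := P.μ) (R := R) (R' := R') hμ hμL
  have hM := proxIters_le (L := P.L) hμ hμL
  have hκ : 1 ≤ P.L / P.μ := (one_le_div hμ).2 hμL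
  have hlog : 0 ≤ Real.log (P.L / P.μ) := Real.log_nonneg hκ
  have hpos : 0 ≤ Real.sqrt (P.L / P.μ) * Real.posLog (R' / R) :=
    mul_nonneg (Real.sqrt_nonneg _) Real.posLog_nonneg
  have hbase : 0 ≤ P.L / P.μ * (1 + Real.log (P.L / P.μ)) := by positivity
  have hq : P.L / P.μ * (R * Real.sqrt (P.μ / ε)) = P.L * R / Real.sqrt (P.μ * ε) := by
    have e1 : Real.sqrt (P.μ / ε) * Real.sqrt (P.μ * ε) = P.μ := by
      rw [← Real.sqrt_mul (by positivity), div_mul_eq_mul_div, mul_div_assoc,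
        mul_div_cancel_right₀ _ hε.ne', Real.sqrt_mul_self hμ.le]
    rw [eq_div_iff (by positivity), div_mul_eq_mul_div, div_mul_eq_mul_div, div_eq_iff hμ.ne']
    linear_combination (P.L * R) * e1
  have hsq : (R * Real.sqrt (P.μ / ε)) ^ 2 * ε = P.μ * R ^ 2 := by
    rw [mul_pow, Real.sq_sqrt (by positivity)]
    field_simp
  have hr : 0 ≤ R * Real.sqrt (P.μ / ε) := by positivity
  set r := R * Real.sqrt (P.μ / ε)
  -- Rounding down keeps T ≤ 3r without an additive constant, even when r is tiny and T = 0; the 2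
  -- in T + 2 compensates. The final error is 4(3/4 + 1/2)μR²/(T+2)² ≤ (5/9)ε.
  have hT1 : (T : ℝ) ≤ 3 * r := hT ▸ Nat.floor_le (by positivity)
  have hT2 : 3 * r ≤ T + 2 := by
    have := (Nat.lt_floor_add_one (3 * r)).le
    rw [← hT] at this
    linarith
  rw [recapp, hw]
  refine solves_det_bind (G' := 10 * proxIters P.L P.μ * T) (B' := 5 * T)
    (h.recappFrom_support (proxIters_pos hμ hμL) T hx₀) hz hmin ?_ (by positivity)
    (expectedGrad_recappFrom_le P _ T x₀) ?_ (expectedBr_recappFrom_le P _ T x₀) ?_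
  · refine (h.expect_recappFrom_le hμ hμL (le_mul_proxIters hμ) hz hmin T hx₀).trans
      (ENNReal.ofReal_le_ofReal ?_)
    rw [div_mul_eq_mul_div, div_le_iff₀ (by positivity)]
    have h1 := hgap z hz
    have h2 : P.μ / 2 * ‖x₀ - z‖ ^ 2 ≤ P.μ / 2 * R ^ 2 := by
      have := h.diam_X _ hx₀ _ hz
      gcongr
    have h3 : (3 * r) ^ 2 ≤ ((T : ℝ) + 2) ^ 2 := by gcongr
    have h4 := mul_le_mul_of_nonneg_left h3 hε.le
    have h5 : 0 ≤ P.μ * R ^ 2 := by positivity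
    linarith
  · push_cast
    have h1 : (proxIters P.L P.μ : ℝ) * T ≤ 81 * (P.L / P.μ) * (3 * r) :=
      mul_le_mul hM hT1 (by positivity) (by positivity)
    rw [← hq]
    have h2 : 0 ≤ P.L / P.μ * r := by positivity
    nlinarith
  · nlinarith

/-- One epoch of restarted RECAPP. -/
theorem expect_epoch_le (h : IsMaxStructured P f R R') (hμ : 0 < P.μ) (hμL : P.μ ≤ P.L)
    {γ : ℝ} (hγ : 0 < γ) (hγμ : γ ≤ P.μ) (hF : StrongConvexOn P.X γ (maxFun f P.Y)) {z : E}
    (hz : z ∈ P.X) (hmin : IsMinOn (maxFun f P.Y) P.X z) {T : ℕ}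
    (hT : 5 * Real.sqrt (P.μ / γ) ≤ T) {x : E} (hx : x ∈ P.X) :
    expect (recappFrom P (proxIters P.L P.μ) 2 T x)
        (fun r => ENNReal.ofReal (maxFun f P.Y r.1 - maxFun f P.Y z))
      ≤ ENNReal.ofReal (Real.exp (-1)) * ENNReal.ofReal (maxFun f P.Y x - maxFun f P.Y z) := by
  refine (h.expect_recappFrom_le hμ hμL (le_mul_proxIters hμ) hz hmin T hx).trans ?_
  rw [← ENNReal.ofReal_mul (Real.exp_pos _).le]
  refine ENNReal.ofReal_le_ofReal ?_
  have h1 := sq_le_sub_of_strongConvexOn hF hx hz hmin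
  set g := maxFun f P.Y x - maxFun f P.Y z
  have hg : 0 ≤ g := le_trans (by positivity) h1
  have h2 : 1 ≤ P.μ / γ := (one_le_div hγ).2 hγμ
  -- Quadratic growth of F turns the distance part of the potential into a multiple of the gap.
  have h3 : P.μ / 2 * ‖x - z‖ ^ 2 ≤ P.μ / γ * g := by
    have := mul_le_mul_of_nonneg_left h1 (by positivity : 0 ≤ P.μ / γ)
    refine le_trans (le_of_eq ?_) this
    field_simp
  have h4 : g + P.μ / 2 * ‖x - z‖ ^ 2 ≤ 2 * (P.μ / γ) * g := by nlinarith
  have h5 : 25 * (P.μ / γ) ≤ ((T : ℝ) + 2) ^ 2 := by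
    have e1 : (5 * Real.sqrt (P.μ / γ)) ^ 2 ≤ ((T : ℝ) + 2) ^ 2 := by gcongr; linarith
    rw [mul_pow, Real.sq_sqrt (by positivity)] at e1
    linarith
  -- The epoch factor is 4 · 2(μ/γ) divided by 25(μ/γ).
  have h6 : (8 / 25 : ℝ) ≤ Real.exp (-1) := by
    have e1 : Real.exp 1 ≤ 25 / 8 := Real.exp_one_lt_d9.le.trans (by norm_num)
    rw [Real.exp_neg, ← inv_div]
    exact inv_anti₀ (Real.exp_pos 1) e1
  refine le_trans ?_ (mul_le_mul_of_nonneg_right h6 hg)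
  rw [div_mul_eq_mul_div, div_le_iff₀ (by positivity)]
  have h7 := mul_le_mul_of_nonneg_right h5 hg
  linarith

/-- Restarted RECAPP. -/
theorem solves_restartedRecapp (h : IsMaxStructured P f R R') (hμ : 0 < P.μ) (hμL : P.μ ≤ P.L)
    (hR : 0 < R) (hR' : 0 < R') {ε γ : ℝ} (hγ : 0 < γ) (hγμ : γ ≤ P.μ)
    (hF : StrongConvexOn P.X γ (maxFun f P.Y)) {x : E} (hx : x ∈ P.X) {y : E'}
    (hy : y ∈ P.Y) {T K : ℕ} (hT : 5 * Real.sqrt (P.μ / γ) ≤ T)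
    (hT' : T ≤ 6 * Real.sqrt (P.μ / γ))
    (hK : Real.exp (-K) * (3 / 4 * (P.L * R ^ 2)) ≤ ε)
    (hK' : K ≤ 5 * Real.posLog (P.L * R ^ 2 / ε)) {C : ℝ} (hC : 24300 ≤ C) :
    Solves (restartedRecapp P (warmParams P.L P.μ R R') (proxIters P.L P.μ) 2 T K x y) P.X
      (maxFun f P.Y) ε
      (C * (P.L / Real.sqrt (P.μ * γ) * Real.posLog (P.L * R ^ 2 / ε)
        + P.L / P.μ * (1 + Real.log (P.L / P.μ))
        + Real.sqrt (P.L / P.μ) * Real.posLog (R' / R)))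
      (C * (Real.sqrt (P.μ / γ) * Real.posLog (P.L * R ^ 2 / ε))) := by
  have hL : 0 < P.L := hμ.trans_le hμL
  obtain ⟨x₀, hx₀, hw, hgap⟩ := h.exists_warmStart_eq hμ hμL hR hR' hx hy rfl
  obtain ⟨z, hz, hmin⟩ := h.exists_isMinOn_maxFun hμ hL.le
  have hcost := warmParams_cost_le (L := P.L) (μ := P.μ) (R := R) (R' := R') hμ hμL
  have hM := proxIters_le (L := P.L) hμ hμL
  have hκ : 1 ≤ P.L / P.μ := (one_le_div hμ).2 hμL
  have hlog : 0 ≤ Real.log (P.L / P.μ) := Real.log_nonneg hκ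
  have hpos : 0 ≤ Real.sqrt (P.L / P.μ) * Real.posLog (R' / R) :=
    mul_nonneg (Real.sqrt_nonneg _) Real.posLog_nonneg
  have hbase : 0 ≤ P.L / P.μ * (1 + Real.log (P.L / P.μ)) := by positivity
  have hq : P.L / P.μ * Real.sqrt (P.μ / γ) = P.L / Real.sqrt (P.μ * γ) := by
    have e1 : Real.sqrt (P.μ / γ) * Real.sqrt (P.μ * γ) = P.μ := by
      rw [← Real.sqrt_mul (by positivity), div_mul_eq_mul_div, mul_div_assoc,
        mul_div_cancel_right₀ _ hγ.ne', Real.sqrt_mul_self hμ.le]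
    rw [eq_div_iff (by positivity), div_mul_eq_mul_div, div_mul_eq_mul_div, div_eq_iff hμ.ne']
    linear_combination P.L * e1
  have hM0 := proxIters_pos hμ hμL
  have hp0 : 0 ≤ Real.posLog (P.L * R ^ 2 / ε) := Real.posLog_nonneg
  have hKT : (K : ℝ) * T ≤ 5 * Real.posLog (P.L * R ^ 2 / ε) * (6 * Real.sqrt (P.μ / γ)) :=
    mul_le_mul hK' hT' (by positivity) (by positivity)
  set p := Real.posLog (P.L * R ^ 2 / ε)
  have hI : ∀ (t : ℕ) (a : E), a ∈ P.X →
      ∀ r ∈ (recappFrom P (proxIters P.L P.μ) 2 T a).law.support, r.1 ∈ P.X :=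
    fun _ a ha => h.recappFrom_support hM0 T ha
  rw [restartedRecapp, hw]
  refine solves_det_bind (G' := K * (10 * proxIters P.L P.μ * T)) (B' := K * (5 * T))
    (loop_invariant hI K hx₀) hz hmin ?_ (by positivity) ?_ ?_ ?_ ?_
  · have h1 := expect_loop_le
      (V := fun _ a => ENNReal.ofReal (maxFun f P.Y a - maxFun f P.Y z)) hI
      (fun t a ha => h.expect_epoch_le hμ hμL hγ hγμ hF hz hmin hT ha) K hx₀
    refine h1.trans ?_
    rw [← ENNReal.ofReal_pow (Real.exp_pos _).le, ← ENNReal.ofReal_mul (by positivity),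
      ← Real.exp_nat_mul]
    refine ENNReal.ofReal_le_ofReal (le_trans ?_ hK)
    rw [mul_neg_one]
    refine mul_le_mul_of_nonneg_left ((hgap z hz).trans ?_) (Real.exp_pos _).le
    gcongr
  · refine (expect_cost_loop_le (fun c => (c.1 : ℝ≥0∞)) (fun c c' => by simp) (by simp) _
      (fun _ a => expectedGrad_recappFrom_le P _ T a) K x₀).trans_eq ?_
    rw [ENNReal.ofReal_mul (p := (K : ℝ)) (by positivity), ENNReal.ofReal_natCast]
  · push_cast
    have h1 : (proxIters P.L P.μ : ℝ) * (K * T)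
        ≤ 81 * (P.L / P.μ) * (5 * p * (6 * Real.sqrt (P.μ / γ))) :=
      mul_le_mul hM hKT (by positivity) (by positivity)
    rw [← hq]
    have h2 : 0 ≤ P.L / P.μ * Real.sqrt (P.μ / γ) * p := by positivity
    nlinarith
  · refine (expect_cost_loop_le (fun c => (c.2 : ℝ≥0∞)) (fun c c' => by simp) (by simp) _
      (fun _ a => expectedBr_recappFrom_le P _ T a) K x₀).trans_eq ?_
    rw [ENNReal.ofReal_mul (p := (K : ℝ)) (by positivity), ENNReal.ofReal_natCast]
  · have h2 : 0 ≤ Real.sqrt (P.μ / γ) * p := by positivity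
    nlinarith

end IsMaxStructured

/-- The number of epochs of restarted RECAPP. -/
theorem exists_epochs {L R ε : ℝ} (hL : 0 < L) (hR : 0 < R) (hε : 0 < ε) :
    ∃ K : ℕ, Real.exp (-K) * (3 / 4 * (L * R ^ 2)) ≤ ε ∧
      (K : ℝ) ≤ 5 * Real.posLog (L * R ^ 2 / ε) := by
  -- K must vanish when log⁺(LR²/ε) does. The warm-start constant 3/4 being below 1 leaves a margin:
  -- in the other case log q ≥ 1/4, so rounding up costs at most 4 log q.
  by_cases hc : 3 / 4 * (L * R ^ 2) ≤ ε
  · exact ⟨0, by simpa using hc, by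
      rw [Nat.cast_zero]; exact mul_nonneg (by norm_num) Real.posLog_nonneg⟩
  · rw [not_le] at hc
    set q := L * R ^ 2 / ε with hq
    have hq0 : 0 < q := by positivity
    have h1 : 4 / 3 ≤ q := by rw [hq, le_div_iff₀ hε]; linarith
    have h2 : 1 / 4 ≤ Real.log q := by
      have e1 := Real.one_sub_inv_le_log_of_pos hq0
      have e2 : q⁻¹ ≤ (4 / 3)⁻¹ := inv_anti₀ (by norm_num) h1
      norm_num at e2
      linarith
    have h3 : Real.log q ≤ Real.posLog q := le_max_right _ _
    refine ⟨⌈Real.log q⌉₊, ?_, ?_⟩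
    · have e1 : Real.exp (-(⌈Real.log q⌉₊ : ℝ)) ≤ q⁻¹ := by
        rw [← Real.exp_log (inv_pos.2 hq0), Real.log_inv]
        exact Real.exp_le_exp.2 (neg_le_neg (Nat.le_ceil _))
      calc _ ≤ q⁻¹ * (3 / 4 * (L * R ^ 2)) := by gcongr
        _ = 3 / 4 * ε := by rw [hq]; field_simp
        _ ≤ ε := by linarith
    · have e1 := (Nat.ceil_lt_add_one (by linarith : 0 ≤ Real.log q)).le
      linarith

end Recapp

end

theorem mainTheorem4 :
    (∃ C : ℝ, 0 < C ∧ ∀ L μ R R' ε : ℝ, 0 < μ → μ ≤ L → 0 < R → 0 < R' → 0 < ε →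
      ∃ (w : Recapp.WarmParams) (M T : ℕ),
        w.Bounded C L μ R R' ∧
        (M : ℝ) ≤ C * (L / μ) ∧
        (T : ℝ) ≤ C * (R * Real.sqrt (μ / ε)) ∧
        ∀ (d d' : ℕ) (P : Recapp.Access (EuclideanSpace ℝ (Fin d)) (EuclideanSpace ℝ (Fin d')))
          (f : EuclideanSpace ℝ (Fin d) → EuclideanSpace ℝ (Fin d') → ℝ),
          P.L = L → P.μ = μ → Recapp.IsMaxStructured P f R R' →
          ∀ xinit ∈ P.X, ∀ yinit ∈ P.Y,
            (∀ r ∈ (Recapp.agd P xinit yinit w.N).law.support,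
              Recapp.maxFun f P.Y xinit - f xinit r.1 ≤ L * R ^ 2 / 2) ∧
            Recapp.Solves (Recapp.recapp P w M 2 T xinit yinit) P.X (Recapp.maxFun f P.Y) ε
              (C * (L * R / Real.sqrt (μ * ε) + L / μ * (1 + Real.log (L / μ))
                + Real.sqrt (L / μ) * Real.posLog (R' / R)))
              (C * (R * Real.sqrt (μ / ε)))) ∧
    (∃ C : ℝ, 0 < C ∧ ∀ L μ R R' ε γ : ℝ, 0 < μ → μ ≤ L → 0 < R → 0 < R' → 0 < ε →
      0 < γ → γ ≤ μ →
      ∃ (w : Recapp.WarmParams) (M T K : ℕ),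
        w.Bounded C L μ R R' ∧
        (M : ℝ) ≤ C * (L / μ) ∧
        (T : ℝ) ≤ C * Real.sqrt (μ / γ) ∧
        (K : ℝ) ≤ C * Real.posLog (L * R ^ 2 / ε) ∧
        ∀ (d d' : ℕ) (P : Recapp.Access (EuclideanSpace ℝ (Fin d)) (EuclideanSpace ℝ (Fin d')))
          (f : EuclideanSpace ℝ (Fin d) → EuclideanSpace ℝ (Fin d') → ℝ),
          P.L = L → P.μ = μ → Recapp.IsMaxStructured P f R R' →
          StrongConvexOn P.X γ (Recapp.maxFun f P.Y) →
          ∀ xinit ∈ P.X, ∀ yinit ∈ P.Y,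
            (∀ r ∈ (Recapp.agd P xinit yinit w.N).law.support,
              Recapp.maxFun f P.Y xinit - f xinit r.1 ≤ L * R ^ 2 / 2) ∧
            Recapp.Solves (Recapp.restartedRecapp P w M 2 T K xinit yinit) P.X
              (Recapp.maxFun f P.Y) ε
              (C * (L / Real.sqrt (μ * γ) * Real.posLog (L * R ^ 2 / ε)
                + L / μ * (1 + Real.log (L / μ))
                + Real.sqrt (L / μ) * Real.posLog (R' / R)))
              (C * (Real.sqrt (μ / γ) * Real.posLog (L * R ^ 2 / ε)))) := by
  constructor
  -- The dominant cost is 10 M T with M ≤ 81 L/μ and T ≤ 3R√(μ/ε), and 10 · 81 · 3 = 2430.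
  · refine ⟨2430, by norm_num, fun L μ R R' ε hμ hμL hR hR' hε =>
      ⟨Recapp.warmParams L μ R R', Recapp.proxIters L μ, ⌊3 * (R * Real.sqrt (μ / ε))⌋₊,
        Recapp.warmParams_bounded hμ hμL (by norm_num), ?_, ?_, ?_⟩⟩
    · have hL : 0 < L := hμ.trans_le hμL
      exact (Recapp.proxIters_le hμ hμL).trans (by gcongr; norm_num)
    · exact (Nat.floor_le (by positivity)).trans (by gcongr; norm_num)
    · rintro d d' P f rfl rfl h x hx y hy
      exact ⟨h.agd_support_le hμ hμL hR hR' hx hy,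
        h.solves_recapp hμ hμL hR hR' hε hx hy rfl le_rfl⟩
  -- Here the dominant cost is 10 M T K, and 10 · 81 · 6 · 5 = 24300.
  · refine ⟨24300, by norm_num, fun L μ R R' ε γ hμ hμL hR hR' hε hγ hγμ => ?_⟩
    have hL : 0 < L := hμ.trans_le hμL
    obtain ⟨K, hK, hK'⟩ := Recapp.exists_epochs hL hR hε
    have h1 : 1 ≤ Real.sqrt (μ / γ) := Real.one_le_sqrt.2 ((one_le_div hγ).2 hγμ)
    have hT : (⌈5 * Real.sqrt (μ / γ)⌉₊ : ℝ) ≤ 6 * Real.sqrt (μ / γ) := by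
      have := (Nat.ceil_lt_add_one (by positivity : 0 ≤ 5 * Real.sqrt (μ / γ))).le
      linarith
    refine ⟨Recapp.warmParams L μ R R', Recapp.proxIters L μ, ⌈5 * Real.sqrt (μ / γ)⌉₊, K,
      Recapp.warmParams_bounded hμ hμL (by norm_num), ?_, ?_, ?_, ?_⟩
    · exact (Recapp.proxIters_le hμ hμL).trans (by gcongr; norm_num)
    · exact hT.trans (by gcongr; norm_num)
    · exact hK'.trans (mul_le_mul_of_nonneg_right (by norm_num) Real.posLog_nonneg)
    · rintro d d' P f rfl rfl h hF x hx y hy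
      exact ⟨h.agd_support_le hμ hμL hR hR' hx hy,
        h.solves_restartedRecapp hμ hμL hR hR' hγ hγμ hF hx hy (Nat.le_ceil _) hT hK hK' le_rfl⟩
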